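/- **Theorem (no-go theorem for norm-based quantumness measures built from linear functionals).** Setting. Consider one optical mode with Hilbert space $\mathcal H=L^2(\mathbb R)$, displacement operators $D(\alpha)$, $\alpha\in\mathbb C$, vacuum $|0\rangle$ and coherent states $|\alpha\rangle=D(\alpha)|0\rangle$. A density operator is *classical* if it is a mixture $\int|\alpha\rangle\langle\alpha|\,d\mu(\alpha)$ of coherent states over a probability measure $\mu$ on $\mathbb C$, and *quantum* otherwise. A *quantumness-breaking channel* is a map $$\mathcal C(X)=\int f(\beta)\,D(\beta)XD(\beta)^\dagger\,\frac{d^2\beta}{\pi},\qquad f:\mathbb C\to\mathbb R \text{ integrable},\quad \int f\,\frac{d^2\beta}{\pi}=1,$$ that sends every density operator to a classical state (it acts on $P$-functions by $P\mapsto P*f$). Let $1\le p<\infty$ be real. A *linear functional* $\mathcal F_L$ is a linear map on the trace-class operators of one of the following two kinds. 1. *Operator-valued*: $\mathcal F_L(X)$ is a bounded operator on a Hilbert space $\mathcal K$, $\|A\|_p=(\mathrm{Tr}\,|A|^p)^{1/p}$ with $|A|=\sqrt{A^\dagger A}$, $\mathcal F_L$ is bounded from the trace norm to $\|\cdot\|_p$,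 and for each $\alpha$ there is a unitary $U_\alpha$ on $\mathcal K$ with $\mathcal F_L(D(\alpha)XD(\alpha)^\dagger)=U_\alpha\mathcal F_L(X)U_\alpha^\dagger$ for all trace-class $X$. 2. *Function-valued*: $\mathcal F_L(X)$ is a complex function on a measure space $(\Omega,\mu)$, $\|\cdot\|_p$ is the $L^p(\Omega,\mu)$ norm with values in $[0,\infty]$, $\mathcal F_L$ is bounded from the trace norm to $L^q(\Omega,\mu)$ for some $q\in[1,\infty]$ (possibly different from $p$), $\|\mathcal F_L(|0\rangle\langle 0|)\|_p<\infty$, and for each $\alpha$ there is a linear map $V_\alpha$ of $L^q(\Omega,\mu)$ preserving $\|\cdot\|_p$ with $\mathcal F_L(D(\alpha)XD(\alpha)^\dagger)=V_\alpha\mathcal F_L(X)$ for all trace-class $X$. (The Wigner function with $p=1$, $q=2$ is an example.) Put $\mathcal N_{\mathcal C}^{p,\mathcal F_L}(\rho)=\|\mathcal F_L(\rho)-\mathcal F_L(\mathcal C(\rho))\|_p$ and $\mathcal M(\rho)=\mathcal N_{\mathcal C}^{p,\mathcal F_L}(\rho)-\mathcal N_{\mathcal C}^{p,\mathcal F_L}(|0\rangle)$.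 Claim. For every $p$, every quantumness-breaking channel $\mathcal C$ and every linear functional $\mathcal F_L$ of either kind, $\mathcal N_{\mathcal C}^{p,\mathcal F_L}(|0\rangle)<\infty$ and there is a density operator $\rho$ such that * $\rho$ has a negative $P$-function: $\rho=\int_{\Omega_+}P_+(\alpha)|\alpha\rangle\langle\alpha|\frac{d^2\alpha}{\pi}-\int_{\Omega_-}P_-(\alpha)|\alpha\rangle\langle\alpha|\frac{d^2\alpha}{\pi}$ with disjoint measurable sets $\Omega_\pm\subset\mathbb C$, $\Omega_-$ of positive area, and $P_\pm$ integrable and strictly positive on $\Omega_\pm$; * $\rho$ is quantum (not classical); * $\mathcal N_{\mathcal C}^{p,\mathcal F_L}(\rho)\le\mathcal N_{\mathcal C}^{p,\mathcal F_L}(|0\rangle)$, that is, $\mathcal M(\rho)\le 0$; and if $\mathcal N_{\mathcal C}^{p,\mathcal F_L}(|0\rangle)\neq0$ then even $\mathcal M(\rho)<0$. Thus the witness $\mathcal M$ fails to detect the quantum state $\rho$, and no universal optimization-free norm-based measure of quantumness arises in this way from linear functionals. -/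

import Mathlib

open MeasureTheory
open scoped ENNReal NNReal

noncomputable section

namespace NoGo

/-! ### Trace and Schatten norms -/

section Schatten

variable {K : Type*} [NormedAddCommGroup K] [InnerProductSpace ℂ K] [CompleteSpace K]

/-- The trace of a positive operator: the sum (possibly `∞`) of its diagonal entries in a Hilbert
basis of `K`. The value does not depend on the basis. -/
def posTrace (T : K →L[ℂ] K) : ℝ≥0∞ :=
  ∑' i : (exists_hilbertBasis ℂ K).choose,
    ENNReal.ofReal (inner ℂ (i : K) (T (i : K))).re

/-- The Schatten `p`-norm `(Tr |A| ^ p) ^ (1 / p)` with `|A| = √(A† A)`, with values in `[0, ∞]`. -/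
def schattenNorm (p : ℝ) (A : K →L[ℂ] K) : ℝ≥0∞ :=
  posTrace (CFC.abs A ^ p) ^ (1 / p)

end Schatten

/-! ### A single optical mode -/

/-- The Hilbert space `L²(ℝ)` of one mode, in the position (quadrature) representation. -/
abbrev Mode : Type := Lp ℂ 2 (volume : Measure ℝ)

/-- Bounded operators of the mode. -/
abbrev Op : Type := Mode →L[ℂ] Mode

/-- The wave function of `D(α) ψ`, where `D(α) = exp (α a† - α* a)`, `a = (x + d/dx) / √2`: with
`α = (q + i k) / √2` it is `x ↦ exp (i k (x - q / 2)) ψ (x - q)`. -/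
def displaceFun (α : ℂ) (ψ : ℝ → ℂ) (x : ℝ) : ℂ :=
  Complex.exp (((√2 * α.im * (x - √2 * α.re / 2) : ℝ) : ℂ) * Complex.I) * ψ (x - √2 * α.re)

lemma displaceFun_memLp (α : ℂ) {ψ : ℝ → ℂ} (h : MemLp ψ 2 (volume : Measure ℝ)) :
    MemLp (displaceFun α ψ) 2 (volume : Measure ℝ) := by
  have h1 : MemLp (fun x : ℝ => ψ (x - √2 * α.re)) 2 (volume : Measure ℝ) :=
    h.comp_measurePreserving (measurePreserving_sub_right volume (√2 * α.re))
  have hc : Continuous fun x : ℝ =>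
      Complex.exp (((√2 * α.im * (x - √2 * α.re / 2) : ℝ) : ℂ) * Complex.I) := by fun_prop
  refine h1.of_le (hc.aestronglyMeasurable.mul h1.1) (Filter.Eventually.of_forall fun x => ?_)
  simp only [displaceFun, norm_mul, Complex.norm_exp_ofReal_mul_I, one_mul, le_refl]

lemma displaceFun_congr (α : ℂ) {ψ φ : ℝ → ℂ} (h : ψ =ᵐ[volume] φ) :
    displaceFun α ψ =ᵐ[volume] displaceFun α φ := by
  have := (measurePreserving_sub_right (volume : Measure ℝ)
    (√2 * α.re)).quasiMeasurePreserving.ae_eq_comp h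
  filter_upwards [this] with x hx
  simp only [Function.comp_apply] at hx
  simp only [displaceFun, hx]

lemma eLpNorm_displaceFun (α : ℂ) {ψ : ℝ → ℂ} (h : MemLp ψ 2 (volume : Measure ℝ)) :
    eLpNorm (displaceFun α ψ) 2 volume = eLpNorm ψ 2 volume := by
  rw [← eLpNorm_comp_measurePreserving h.1
    (measurePreserving_sub_right (volume : Measure ℝ) (√2 * α.re))]
  refine eLpNorm_congr_norm_ae (Filter.Eventually.of_forall fun x => ?_)
  simp only [displaceFun, norm_mul, Complex.norm_exp_ofReal_mul_I, one_mul, Function.comp_apply]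

/-- The displacement operator `D(α)` as a linear isometry of `L²(ℝ)`. -/
def displacementIsometry (α : ℂ) : Mode →ₗᵢ[ℂ] Mode where
  toFun ψ := (displaceFun_memLp α (Lp.memLp ψ)).toLp _
  map_add' ψ φ := by
    rw [← MemLp.toLp_add]
    refine MemLp.toLp_congr _ _ ((displaceFun_congr α (Lp.coeFn_add ψ φ)).trans ?_)
    refine Filter.Eventually.of_forall fun x => ?_
    simp only [displaceFun, Pi.add_apply, mul_add]
  map_smul' c ψ := by
    rw [RingHom.id_apply, ← MemLp.toLp_const_smul]
    refine MemLp.toLp_congr _ _ ((displaceFun_congr α (Lp.coeFn_smul c ψ)).trans ?_)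
    refine Filter.Eventually.of_forall fun x => ?_
    simp only [displaceFun, Pi.smul_apply, smul_eq_mul]
    ring
  norm_map' ψ := by
    change ‖(displaceFun_memLp α (Lp.memLp ψ)).toLp _‖ = ‖ψ‖
    rw [Lp.norm_toLp, eLpNorm_displaceFun α (Lp.memLp ψ), Lp.norm_def]

/-- The displacement operator `D(α)`. -/
def displacement (α : ℂ) : Op := (displacementIsometry α).toContinuousLinearMap

/-- The wave function `π ^ (-1/4) exp (- x² / 2)` of the vacuum. -/
def vacuumFun (x : ℝ) : ℂ := ((Real.pi ^ (-(1 / 4) : ℝ) * Real.exp (-(1 / 2) * x ^ 2) : ℝ) : ℂ)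

lemma vacuumFun_memLp : MemLp vacuumFun 2 (volume : Measure ℝ) := by
  have hc : Continuous vacuumFun := by unfold vacuumFun; fun_prop
  rw [memLp_two_iff_integrable_sq_norm hc.aestronglyMeasurable]
  have := (integrable_exp_neg_mul_sq (b := 1) one_pos).const_mul
    ((Real.pi ^ (-(1 / 4) : ℝ)) ^ 2)
  refine this.congr (Filter.Eventually.of_forall fun x => ?_)
  simp only [vacuumFun, Complex.norm_real, Real.norm_eq_abs, sq_abs, mul_pow]
  rw [← Real.exp_nat_mul]
  congr 2
  push_cast
  ring

/-- The vacuum vector. -/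
def vacuumVec : Mode := vacuumFun_memLp.toLp _

/-- The coherent vector `|α⟩ = D(α) |0⟩`. -/
def coherentVec (α : ℂ) : Mode := displacement α vacuumVec

/-- The coherent state `|α⟩⟨α|`. -/
def coherentState (α : ℂ) : Op :=
  InnerProductSpace.rankOne ℂ (coherentVec α) (coherentVec α)

/-- The vacuum state `|0⟩⟨0|`. -/
def vacuumState : Op := coherentState 0

/-- The measure `d²α / π` on phase space. -/
def phaseMeasure : Measure ℂ := ENNReal.ofReal Real.pi⁻¹ • volume

/-- Density operators: positive operators of trace one. -/
def IsDensityOperator (ρ : Op) : Prop := ρ.IsPositive ∧ posTrace ρ = 1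

/-- Classical states: density operators that are mixtures `∫ |α⟩⟨α| dμ(α)` of coherent states over
a probability measure `μ` on phase space (`dμ = P d²α / π` when `P` is a function; coherent states
themselves correspond to point masses). A density operator that is not classical is quantum. -/
def IsClassicalState (ρ : Op) : Prop :=
  IsDensityOperator ρ ∧
    ∃ μ : Measure ℂ, IsProbabilityMeasure μ ∧ ρ = ∫ α, coherentState α ∂μ

/-- `ρ = ∫ P(α) |α⟩⟨α| d²α / π` with `P = P₊ - P₋`, where `P₊` and `P₋` are integrable and strictly
positive on disjoint regions `Ω₊` and `Ω₋`, and the negative region `Ω₋` has positive area. -/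
def HasNegativePFunction (ρ : Op) : Prop :=
  ∃ (Ωp Ωm : Set ℂ) (Pp Pm : ℂ → ℝ),
    MeasurableSet Ωp ∧ MeasurableSet Ωm ∧ Disjoint Ωp Ωm ∧ 0 < volume Ωm ∧
    (∀ α ∈ Ωp, 0 < Pp α) ∧ (∀ α ∈ Ωm, 0 < Pm α) ∧
    IntegrableOn Pp Ωp phaseMeasure ∧ IntegrableOn Pm Ωm phaseMeasure ∧
    ρ = ∫ α in Ωp, ((Pp α : ℝ) : ℂ) • coherentState α ∂phaseMeasure -
        ∫ α in Ωm, ((Pm α : ℝ) : ℂ) • coherentState α ∂phaseMeasure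

/-! ### Quantumness-breaking channels -/

/-- `D(α) X D(α)†`. -/
def displace (α : ℂ) (X : Op) : Op :=
  displacement α ∘L X ∘L ContinuousLinearMap.adjoint (displacement α)

/-- The map `X ↦ ∫ f(β) D(β) X D(β)† d²β / π`; on P-functions it is `P ↦ P * f`. -/
def smoothingChannel (f : ℂ → ℝ) (X : Op) : Op :=
  ∫ β, ((f β : ℝ) : ℂ) • displace β X ∂phaseMeasure

/-- `f` is the smoothing function of a quantumness-breaking channel: it is integrable, normalised,
and its channel sends every density operator to a classical state. (Nonnegativity of `f` almost
everywhere is a consequence.) -/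
structure IsQuantumnessBreaking (f : ℂ → ℝ) : Prop where
  integrable : Integrable f phaseMeasure
  normalised : ∫ β, f β ∂phaseMeasure = 1
  classical : ∀ ρ, IsDensityOperator ρ → IsClassicalState (smoothingChannel f ρ)

/-! ### Linear functionals of states, the norm-based measure and the witness -/

/-- Operator-valued linear functionals for the Schatten `p`-norm: `F` is bounded from the trace
norm to the `p`-norm, and displacements are implemented by unitaries on the image. Only the values
of `F` on trace-class operators are used (every linear map defined on these extends linearly). -/
structure IsOperatorFunctional {K : Type*} [NormedAddCommGroup K] [InnerProductSpace ℂ K]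
    [CompleteSpace K] (p : ℝ) (F : Op →ₗ[ℂ] (K →L[ℂ] K)) : Prop where
  bounded : ∃ c : ℝ≥0, ∀ X : Op, schattenNorm 1 X < ∞ →
    schattenNorm p (F X) ≤ c * schattenNorm 1 X
  covariant : ∀ α : ℂ, ∃ U ∈ unitary (K →L[ℂ] K), ∀ X : Op, schattenNorm 1 X < ∞ →
    F (displace α X) = U * F X * star U

/-- Function-valued linear functionals for the `L^p`-norm: `F` is bounded from the trace norm to
some `L^q(Ω, μ)`, it sends the vacuum to a function with finite `L^p`-norm, and displacements are
implemented by linear maps of the image that preserve the `L^p`-norm. The exponent `q` may differ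
from `p`: the Wigner function is bounded and square integrable for every state, but its
`L¹`-norm is infinite for some states. Only the values of `F` on trace-class operators are used. -/
structure IsFunctionFunctional {Ω : Type*} [MeasurableSpace Ω] (μ : Measure Ω) (p : ℝ)
    (q : ℝ≥0∞) (F : Op →ₗ[ℂ] Lp ℂ q μ) : Prop where
  bounded : ∃ c : ℝ≥0, ∀ X : Op, schattenNorm 1 X < ∞ →
    eLpNorm (F X) q μ ≤ c * schattenNorm 1 X
  finite_vacuum : eLpNorm (F vacuumState) (ENNReal.ofReal p) μ < ∞
  covariant : ∀ α : ℂ, ∃ V : Lp ℂ q μ →ₗ[ℂ] Lp ℂ q μ,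
    (∀ g, eLpNorm (V g) (ENNReal.ofReal p) μ = eLpNorm g (ENNReal.ofReal p) μ) ∧
    ∀ X : Op, schattenNorm 1 X < ∞ → F (displace α X) = V (F X)

/-- `N(ρ) = ‖F(ρ) - F(C(ρ))‖_p` for an operator-valued functional `F`. -/
def operatorMeasure {K : Type*} [NormedAddCommGroup K] [InnerProductSpace ℂ K]
    [CompleteSpace K] (p : ℝ) (F : Op →ₗ[ℂ] (K →L[ℂ] K)) (f : ℂ → ℝ) (ρ : Op) : ℝ≥0∞ :=
  schattenNorm p (F ρ - F (smoothingChannel f ρ))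

/-- `N(ρ) = ‖F(ρ) - F(C(ρ))‖_p` for a function-valued functional `F`. -/
def functionMeasure {Ω : Type*} [MeasurableSpace Ω] (μ : Measure Ω) (p : ℝ) (q : ℝ≥0∞)
    (F : Op →ₗ[ℂ] Lp ℂ q μ) (f : ℂ → ℝ) (ρ : Op) : ℝ≥0∞ :=
  eLpNorm (F ρ - F (smoothingChannel f ρ) : Lp ℂ q μ) (ENNReal.ofReal p) μ

/-- The quantumness witness `M(ρ) = N(ρ) - N(|0⟩)` (for finite values of `N`). -/
def witness (N : Op → ℝ≥0∞) (ρ : Op) : ℝ := (N ρ).toReal - (N vacuumState).toReal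

end NoGo

end

/-! The theorem holds because some nonclassical states are almost invariant under the channel. Let
`P` equal a constant `c` on the disc of radius `R`, except on the unit disc, where it equals `-c *
exp (-16)` (`dimpledDisc`). Normalisation forces `c` to be of order `R⁻²`. Translating `P` by `β`
changes it only near the boundary circles, so the `L¹` change is `O(1 / R)` for fixed `β`. Since `∫
f = 1`, dominated convergence gives `‖P - P * f‖₁ → 0` as `R → ∞` (`exists_almost_invariant_state`).

Positivity of the operator rests on complex analysis. The overlap `⟪ψ, α⟫` times `exp (|α|² / 2)` is
entire, so by the mean value property its squared modulus on the unit disc is controlled by its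
integral over a surrounding annulus (`lintegral_disc_le_annulus`). A shallow enough negative disc is
therefore compensated. The state is nonclassical because the P-function is unique: the Husimi
function is a Gaussian convolution of `P`, and the Fourier transform of a Gaussian has no zeros
(`measure_eq_of_husimi_eq`).

A functional gives `N(ρ) ≤ C ‖P - P * f‖₁`. If `N(|0⟩) ≠ 0`, a large `R` makes `N(ρ)` strictly
smaller. If `N(|0⟩) = 0`, covariance makes `F` vanish on `|α⟩⟨α| - C(|α⟩⟨α|)` for every `α`, and
approximation by finite combinations of coherent states (`exists_finite_approx`) gives `N(ρ) = 0`.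
The two cases are combined in `exists_undetected_state`.

Trace norms are bounded through `TraceBound`, a duality estimate that is visibly stable under sums,
integrals and displacements; `TraceBound.schattenNorm_le` converts it to `schattenNorm 1`. -/

noncomputable section

namespace NoGo

/-! ### Trace norm estimates -/

section TraceBound

variable {K : Type*} [NormedAddCommGroup K] [InnerProductSpace ℂ K]

/-- Finite families satisfying Bessel's inequality. -/
def IsBessel {n : ℕ} (x : Fin n → K) : Prop :=
  ∀ u : K, ∑ i, ‖(inner ℂ (x i) u : ℂ)‖ ^ 2 ≤ ‖u‖ ^ 2

/-- `c` bounds the sums `∑ ⟪x i, T (y i)⟫` over finite Bessel families, hence the trace norm. -/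
def TraceBound (T : K →L[ℂ] K) (c : ℝ) : Prop :=
  ∀ (n : ℕ) (x y : Fin n → K), IsBessel x → IsBessel y →
    ‖∑ i, (inner ℂ (x i) (T (y i)) : ℂ)‖ ≤ c

lemma TraceBound.nonneg {T : K →L[ℂ] K} {c : ℝ} (h : TraceBound T c) : 0 ≤ c := by
  simpa using h 0 Fin.elim0 Fin.elim0 (by simp [IsBessel]) (by simp [IsBessel])

lemma TraceBound.mono {T : K →L[ℂ] K} {c d : ℝ} (h : TraceBound T c) (hcd : c ≤ d) :
    TraceBound T d := fun n x y hx hy => (h n x y hx hy).trans hcd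

lemma TraceBound.add {S T : K →L[ℂ] K} {c d : ℝ} (hS : TraceBound S c) (hT : TraceBound T d) :
    TraceBound (S + T) (c + d) := fun n x y hx hy => by
  simp only [add_apply, inner_add_right, Finset.sum_add_distrib]
  exact (norm_add_le _ _).trans (add_le_add (hS n x y hx hy) (hT n x y hx hy))

lemma TraceBound.smul {T : K →L[ℂ] K} {c : ℝ} (hT : TraceBound T c) (a : ℂ) :
    TraceBound (a • T) (‖a‖ * c) := fun n x y hx hy => by
  simp only [smul_apply, inner_smul_right, ← Finset.mul_sum, norm_mul]
  exact mul_le_mul_of_nonneg_left (hT n x y hx hy) (norm_nonneg _)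

lemma TraceBound.neg {T : K →L[ℂ] K} {c : ℝ} (hT : TraceBound T c) : TraceBound (-T) c := by
  simpa using hT.smul (-1)

lemma TraceBound.sub {S T : K →L[ℂ] K} {c d : ℝ} (hS : TraceBound S c) (hT : TraceBound T d) :
    TraceBound (S - T) (c + d) := by
  simpa [sub_eq_add_neg] using hS.add hT.neg

/-- Cauchy–Schwarz over the index, then the Bessel inequality for each family. -/
lemma traceBound_rankOne (u v : K) :
    TraceBound (InnerProductSpace.rankOne ℂ u v) (‖u‖ * ‖v‖) := fun n x y hx hy => by
  have h2 : ∀ i, ‖(inner ℂ (x i) (InnerProductSpace.rankOne ℂ u v (y i)) : ℂ)‖ =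
      ‖(inner ℂ (x i) u : ℂ)‖ * ‖(inner ℂ (y i) v : ℂ)‖ := fun i => by
    simp only [InnerProductSpace.rankOne_apply, inner_smul_right, norm_mul]
    rw [norm_inner_symm v, mul_comm]
  refine (norm_sum_le _ _).trans ?_
  simp only [h2]
  refine (Real.sum_mul_le_sqrt_mul_sqrt _ _ _).trans ?_
  refine mul_le_mul ?_ ?_ (Real.sqrt_nonneg _) (norm_nonneg _)
  · exact Real.sqrt_le_iff.2 ⟨norm_nonneg _, hx u⟩
  · exact Real.sqrt_le_iff.2 ⟨norm_nonneg _, hy v⟩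

/-- Continuity of projectors in trace norm, by telescoping the difference into two rank-one
operators that each contain `u - v`. -/
lemma traceBound_rankOne_self_sub {u v : K} (hu : ‖u‖ = 1) (hv : ‖v‖ = 1) :
    TraceBound (InnerProductSpace.rankOne ℂ u u - InnerProductSpace.rankOne ℂ v v)
      (2 * ‖u - v‖) := by
  have h : InnerProductSpace.rankOne ℂ u u - InnerProductSpace.rankOne ℂ v v =
      InnerProductSpace.rankOne ℂ u (u - v) + InnerProductSpace.rankOne ℂ (u - v) v := by
    ext z
    simp only [sub_apply, add_apply,
      InnerProductSpace.rankOne_apply, inner_sub_left]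
    module
  rw [h]
  refine ((traceBound_rankOne _ _).add (traceBound_rankOne _ _)).mono ?_
  rw [hu, hv]
  linarith

lemma TraceBound.integral {X : Type*} [MeasurableSpace X] {ν : Measure X}
    {T : X → K →L[ℂ] K} {b : X → ℝ} [CompleteSpace K] (hT : Integrable T ν) (hb : Integrable b ν)
    (h : ∀ a, TraceBound (T a) (b a)) : TraceBound (∫ a, T a ∂ν) (∫ a, b a ∂ν) :=
  fun n x y hx hy => by
  have hi : ∀ i, Integrable (fun a => (inner ℂ (x i) (T a (y i)) : ℂ)) ν := fun i =>
    ((innerSL ℂ (x i)).comp (ContinuousLinearMap.apply ℂ K (y i))).integrable_comp hT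
  have h1 : ∀ i, (inner ℂ (x i) ((∫ a, T a ∂ν) (y i)) : ℂ) = ∫ a, inner ℂ (x i) (T a (y i)) ∂ν :=
    fun i => (((innerSL ℂ (x i)).comp (ContinuousLinearMap.apply ℂ K (y i))).integral_comp_comm
      hT).symm
  simp only [h1]
  rw [← integral_finsetSum _ (fun i _ => hi i)]
  exact norm_integral_le_of_norm_le hb (Filter.Eventually.of_forall fun a => h a n x y hx hy)

lemma Orthonormal.isBessel_comp {ι : Type*} {e : ι → K} (he : Orthonormal ℂ e) (s : Finset ι) :
    IsBessel fun i : Fin s.card => e (s.equivFin.symm i) := fun u => by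
  rw [Equiv.sum_comp s.equivFin.symm (fun i : s => ‖(inner ℂ (e i) u : ℂ)‖ ^ 2),
    Finset.sum_coe_sort s (fun i => ‖(inner ℂ (e i) u : ℂ)‖ ^ 2)]
  exact he.sum_inner_products_le u

variable [CompleteSpace K]

lemma IsBessel.map_contraction {n : ℕ} {x : Fin n → K} (hx : IsBessel x) {G : K →L[ℂ] K}
    (hG : ‖G‖ ≤ 1) : IsBessel fun i => ContinuousLinearMap.adjoint G (x i) := fun u => by
  simp only [ContinuousLinearMap.adjoint_inner_left]
  refine (hx (G u)).trans ?_
  have : ‖G u‖ ≤ 1 * ‖u‖ := G.le_of_opNorm_le hG u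
  rw [one_mul] at this
  gcongr

lemma TraceBound.conj {T : K →L[ℂ] K} {c : ℝ} (hT : TraceBound T c) {G : K →L[ℂ] K}
    (hG : ‖G‖ ≤ 1) : TraceBound (G ∘L T ∘L ContinuousLinearMap.adjoint G) c :=
  fun n x y hx hy => by
  simp only [ContinuousLinearMap.comp_apply]
  have := hT n _ _ (hx.map_contraction hG) (hy.map_contraction hG)
  simpa only [ContinuousLinearMap.adjoint_inner_left] using this

/-- An approximate polar decomposition: contractions `g` with `g t` close to `|t|`. -/
lemma exists_contraction_mul_close_abs {A : Type*} [CStarAlgebra A] [PartialOrder A]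
    [StarOrderedRing A] (x : A) {ε : ℝ} (hε : 0 < ε) :
    ∃ g : A, ‖g‖ ≤ 1 ∧ ‖g * x - CFC.abs x‖ ≤ ε := by
  have haa : star x * x = CFC.abs x * CFC.abs x := (CFC.abs_mul_abs x).symm
  have ha0 : 0 ≤ CFC.abs x := CFC.abs_nonneg x
  generalize CFC.abs x = a at haa ha0
  have hsa : IsSelfAdjoint a := .of_nonneg ha0
  have hsp : ∀ t ∈ spectrum ℝ a, 0 ≤ t := fun t ht => spectrum_nonneg_of_nonneg ha0 ht
  have hk : ContinuousOn (fun t : ℝ => (t + ε)⁻¹) (spectrum ℝ a) := by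
    refine ContinuousOn.inv₀ (by fun_prop) fun t ht => ?_
    have := hsp t ht
    positivity
  have hi : ContinuousOn (fun t : ℝ => t) (spectrum ℝ a) := continuousOn_id
  have hm : ContinuousOn (fun t : ℝ => t * t) (spectrum ℝ a) := hi.mul hi
  have hkm := hk.mul hm
  have hid : cfc (fun t : ℝ => t) a = a := cfc_id' ℝ a hsa
  have hsq : cfc (fun t : ℝ => t * t) a = star x * x := by
    rw [cfc_mul (fun t : ℝ => t) (fun t : ℝ => t) a hi hi, hid, haa]
  have hks : star (cfc (fun t : ℝ => (t + ε)⁻¹) a) = cfc (fun t : ℝ => (t + ε)⁻¹) a :=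
    (cfc_predicate (fun t : ℝ => (t + ε)⁻¹) a).star_eq
  -- With `a = |x|`, the element `(a + ε)⁻¹ x†` regularises the adjoint of the polar part. Its norm
  -- squared is governed by `(t / (t + ε))² ≤ 1`, and its product with `x` differs from `a` by `ε t
  -- / (t + ε) ≤ ε`.
  refine ⟨cfc (fun t : ℝ => (t + ε)⁻¹) a * star x, ?_, ?_⟩
  · have h1 : ‖cfc (fun t : ℝ => (t + ε)⁻¹) a * star x‖ *
        ‖cfc (fun t : ℝ => (t + ε)⁻¹) a * star x‖ ≤ 1 := by
      rw [← CStarRing.norm_self_mul_star, star_mul, star_star, hks]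
      have : cfc (fun t : ℝ => (t + ε)⁻¹) a * star x * (x * cfc (fun t : ℝ => (t + ε)⁻¹) a) =
          cfc (fun t : ℝ => (t + ε)⁻¹ * (t * t) * (t + ε)⁻¹) a := by
        rw [cfc_mul (fun t : ℝ => (t + ε)⁻¹ * (t * t)) (fun t : ℝ => (t + ε)⁻¹) a hkm hk,
          cfc_mul (fun t : ℝ => (t + ε)⁻¹) (fun t : ℝ => t * t) a hk hm, hsq]
        simp only [mul_assoc]
      rw [this]
      refine norm_cfc_le zero_le_one fun t ht => ?_
      have ht0 := hsp t ht
      have h2 : (t + ε)⁻¹ * (t * t) * (t + ε)⁻¹ = (t / (t + ε)) ^ 2 := by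
        field_simp
      rw [h2, Real.norm_eq_abs, abs_of_nonneg (by positivity)]
      refine pow_le_one₀ (by positivity) ?_
      rw [div_le_one (by positivity)]
      linarith
    nlinarith [norm_nonneg (cfc (fun t : ℝ => (t + ε)⁻¹) a * star x)]
  · have : cfc (fun t : ℝ => (t + ε)⁻¹) a * star x * x - a =
        cfc (fun t : ℝ => (t + ε)⁻¹ * (t * t) - t) a := by
      rw [cfc_sub (fun t : ℝ => (t + ε)⁻¹ * (t * t)) (fun t : ℝ => t) a hkm hi,
        cfc_mul (fun t : ℝ => (t + ε)⁻¹) (fun t : ℝ => t * t) a hk hm, hsq, hid]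
      simp only [mul_assoc]
    rw [this]
    refine norm_cfc_le hε.le fun t ht => ?_
    have ht0 := hsp t ht
    have h2 : (t + ε)⁻¹ * (t * t) - t = -(ε * (t / (t + ε))) := by
      field_simp
      ring
    rw [h2, norm_neg, Real.norm_eq_abs, abs_of_nonneg (by positivity)]
    refine mul_le_of_le_one_right hε.le ?_
    rw [div_le_one (by positivity)]
    linarith

lemma eq_zero_of_abs_rpow_eq_zero {A : Type*} [CStarAlgebra A] [PartialOrder A]
    [StarOrderedRing A] {p : ℝ} (hp : 0 < p) {x : A} (h : CFC.abs x ^ p = 0) : x = 0 := by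
  have h3 : CFC.abs x = (CFC.abs x ^ p) ^ p⁻¹ := by
    rw [CFC.rpow_rpow_of_exponent_nonneg _ _ _ hp.le (inv_nonneg.2 hp.le) (CFC.abs_nonneg x),
      mul_inv_cancel₀ hp.ne', CFC.rpow_one _ (CFC.abs_nonneg x)]
  rw [h, show (0 : A) ^ p⁻¹ = 0 from CFC.zero_rpow (inv_ne_zero hp.ne')] at h3
  exact CFC.abs_eq_zero_iff.1 h3

variable (K) in
lemma orthonormal_chosen :
    Orthonormal ℂ ((↑) : (exists_hilbertBasis ℂ K).choose → K) := by
  obtain ⟨b, hb⟩ := (exists_hilbertBasis ℂ K).choose_spec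
  rw [← hb]
  exact b.orthonormal

/-- On finitely many basis vectors, `⟪e, |T| e⟫` is close to `⟪e, G T e⟫ = ⟪G† e, T e⟫` for a
contraction `G`. The families `G† e` and `e` are both Bessel, so the hypothesis bounds the sum. -/
lemma TraceBound.schattenNorm_le {T : K →L[ℂ] K} {c : ℝ} (h : TraceBound T c) :
    schattenNorm 1 T ≤ ENNReal.ofReal c := by
  have hpos : ∀ u : K, 0 ≤ (inner ℂ u (CFC.abs T u) : ℂ).re := fun u =>
    ((ContinuousLinearMap.nonneg_iff_isPositive _).1 (CFC.abs_nonneg T)).re_inner_nonneg_right u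
  simp only [schattenNorm, CFC.rpow_one _ (CFC.abs_nonneg T), div_one, ENNReal.rpow_one, posTrace]
  rw [ENNReal.tsum_eq_iSup_sum]
  refine iSup_le fun s => ?_
  rw [← ENNReal.ofReal_sum_of_nonneg (s := s)
    (f := fun i => (inner ℂ (i : K) (CFC.abs T (i : K)) : ℂ).re) fun i _ => hpos (i : K)]
  refine ENNReal.ofReal_le_ofReal (le_of_forall_pos_le_add fun δ hδ => ?_)
  have hs : (0 : ℝ) < s.card + 1 := by positivity
  -- An error of `δ / (s.card + 1)` per vector adds up to at most `δ`; the `+ 1` covers the empty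
  -- `s`.
  obtain ⟨G, hG, hGT⟩ := exists_contraction_mul_close_abs T (div_pos hδ hs)
  have hB := Orthonormal.isBessel_comp (orthonormal_chosen K) s
  have h1 := h _ _ _ (hB.map_contraction hG) hB
  simp only [ContinuousLinearMap.adjoint_inner_left] at h1
  rw [Equiv.sum_comp s.equivFin.symm (fun i : s => (inner ℂ ((i : _) : K) (G (T ((i : _) : K))) : ℂ)),
    Finset.sum_coe_sort s (fun i => (inner ℂ (i : K) (G (T (i : K))) : ℂ))] at h1
  have h2 : ∀ i ∈ s, (inner ℂ (i : K) (CFC.abs T (i : K)) : ℂ).re ≤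
      (inner ℂ (i : K) (G (T (i : K))) : ℂ).re + δ / (s.card + 1) := fun i _ => by
    have h3 : (inner ℂ (i : K) (CFC.abs T (i : K)) : ℂ) = inner ℂ (i : K) (G (T (i : K))) -
        inner ℂ (i : K) ((G * T - CFC.abs T) (i : K)) := by
      simp
    have h4 : ‖(inner ℂ (i : K) ((G * T - CFC.abs T) (i : K)) : ℂ)‖ ≤ δ / (s.card + 1) := by
      refine (norm_inner_le_norm _ _).trans ?_
      have h5 : ‖(i : K)‖ = 1 := (orthonormal_chosen K).1 i
      have := (G * T - CFC.abs T).le_of_opNorm_le hGT (i : K)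
      rw [h5] at this ⊢
      linarith
    rw [h3, Complex.sub_re]
    have := (abs_le.1 ((Complex.abs_re_le_norm _).trans h4)).1
    linarith
  refine (Finset.sum_le_sum h2).trans ?_
  rw [Finset.sum_add_distrib, ← Complex.re_sum, Finset.sum_const, nsmul_eq_mul]
  refine add_le_add ((Complex.re_le_norm _).trans h1) ?_
  rw [mul_div_assoc', div_le_iff₀ hs]
  nlinarith

lemma TraceBound.schattenNorm_lt_top {T : K →L[ℂ] K} {c : ℝ} (h : TraceBound T c) :
    schattenNorm 1 T < ∞ := h.schattenNorm_le.trans_lt ENNReal.ofReal_lt_top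

/-- The diagonal entries are `‖√T e‖²`, so `√T` kills a Hilbert basis. -/
lemma eq_zero_of_posTrace_eq_zero {T : K →L[ℂ] K} (hT : 0 ≤ T) (h : posTrace T = 0) : T = 0 := by
  have hs : star (CFC.sqrt T) * CFC.sqrt T = T := by
    rw [(IsSelfAdjoint.of_nonneg (CFC.sqrt_nonneg T)).star_eq, CFC.sqrt_mul_sqrt_self T hT]
  suffices CFC.sqrt T = 0 by rw [← hs, this, mul_zero]
  obtain ⟨b, hb⟩ := (exists_hilbertBasis ℂ K).choose_spec
  have h0 : ∀ i, CFC.sqrt T (b i) = 0 := fun i => by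
    have h1 := ENNReal.tsum_eq_zero.1 h i
    rw [ENNReal.ofReal_eq_zero] at h1
    have h2 : (inner ℂ (b i) (T (b i)) : ℂ) = (‖CFC.sqrt T (b i)‖ : ℂ) ^ 2 := by
      refine Eq.trans ?_ (inner_self_eq_norm_sq_to_K (𝕜 := ℂ) (CFC.sqrt T (b i)))
      conv_lhs => rw [← hs]
      rw [mul_apply_eq_comp, ContinuousLinearMap.star_eq_adjoint,
        ContinuousLinearMap.adjoint_inner_right]
    rw [← hb, h2, ← Complex.ofReal_pow, Complex.ofReal_re] at h1
    have h3 := sq_nonneg ‖CFC.sqrt T (b i)‖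
    exact norm_eq_zero.1 (pow_eq_zero_iff two_ne_zero |>.1 (le_antisymm h1 h3))
  have hd : Dense (Submodule.span ℂ (Set.range b) : Set K) := by
    rw [Submodule.dense_iff_topologicalClosure_eq_top]
    exact b.dense_span
  refine ContinuousLinearMap.ext_on hd ?_
  rintro _ ⟨i, rfl⟩
  simpa using h0 i

lemma eq_zero_of_schattenNorm_eq_zero {p : ℝ} (hp : 0 < p) {A : K →L[ℂ] K}
    (h : schattenNorm p A = 0) : A = 0 := by
  have h1 : posTrace (CFC.abs A ^ p) = 0 := by
    simpa [schattenNorm, ENNReal.rpow_eq_zero_iff, hp, hp.not_gt] using h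
  exact eq_zero_of_abs_rpow_eq_zero hp (eq_zero_of_posTrace_eq_zero CFC.rpow_nonneg h1)

end TraceBound

/-! ### Coherent states -/

lemma coherentVec_ae (α : ℂ) : coherentVec α =ᵐ[volume] displaceFun α vacuumFun :=
  (MemLp.coeFn_toLp (displaceFun_memLp α (Lp.memLp vacuumVec))).trans
    (displaceFun_congr α (MemLp.coeFn_toLp vacuumFun_memLp))

/-- The Gaussian exponent of `⟪α, β⟫`. -/
lemma conj_displaceFun_vacuumFun_mul (α β : ℂ) (x : ℝ) :
    displaceFun β vacuumFun x * (starRingEnd ℂ) (displaceFun α vacuumFun x) =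
      ((Real.pi ^ (-(1 / 2) : ℝ) : ℝ) : ℂ) *
      Complex.exp (-1 * (x : ℂ) ^ 2 + ((√2 : ℝ) * (starRingEnd ℂ α + β)) * x +
        (-α.re ^ 2 - β.re ^ 2 + (α.re * α.im - β.re * β.im) * Complex.I)) := by
  have h2 : ((√2 : ℝ) : ℂ) ^ 2 = 2 := by
    rw [← Complex.ofReal_pow, Real.sq_sqrt zero_le_two]; norm_num
  have hpi : ((Real.pi ^ (-(1 / 4) : ℝ) : ℝ) : ℂ) * ((Real.pi ^ (-(1 / 4) : ℝ) : ℝ) : ℂ) =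
      ((Real.pi ^ (-(1 / 2) : ℝ) : ℝ) : ℂ) := by
    rw [← Complex.ofReal_mul, ← Real.rpow_add Real.pi_pos]; norm_num
  have hα : starRingEnd ℂ α = α.re - α.im * Complex.I := by
    apply Complex.ext <;> simp
  have hβ := (Complex.re_add_im β).symm
  simp only [displaceFun, vacuumFun, map_mul, ← Complex.exp_conj, Complex.conj_ofReal,
    Complex.conj_I]
  rw [← hpi]
  simp only [Complex.ofReal_mul, Complex.ofReal_exp]
  rw [show ∀ a b c d e f : ℂ, a * (b * c) * (d * (e * f)) = (b * e) * (a * c * d * f) by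
    intros; ring]
  simp only [← Complex.exp_add]
  congr 2
  rw [hα]
  generalize β.re = a at *
  generalize β.im = b at *
  rw [hβ]
  push_cast
  linear_combination (-(α.re : ℂ) ^ 2 / 2 - a ^ 2 / 2 + (α.re * α.im - a * b) * Complex.I / 2) * h2

lemma inner_coherentVec (α β : ℂ) : (inner ℂ (coherentVec α) (coherentVec β) : ℂ) =
    Complex.exp (starRingEnd ℂ α * β - (‖α‖ : ℂ) ^ 2 / 2 - (‖β‖ : ℂ) ^ 2 / 2) := by
  have h2 : ((√2 : ℝ) : ℂ) ^ 2 = 2 := by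
    rw [← Complex.ofReal_pow, Real.sq_sqrt zero_le_two]; norm_num
  rw [L2.inner_def]
  have : (fun x => (inner ℂ (coherentVec α x) (coherentVec β x) : ℂ)) =ᵐ[volume] fun x : ℝ =>
      ((Real.pi ^ (-(1 / 2) : ℝ) : ℝ) : ℂ) *
      Complex.exp (-1 * (x : ℂ) ^ 2 + ((√2 : ℝ) * (starRingEnd ℂ α + β)) * x +
        (-α.re ^ 2 - β.re ^ 2 + (α.re * α.im - β.re * β.im) * Complex.I)) := by
    filter_upwards [coherentVec_ae α, coherentVec_ae β] with x h1 h2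
    rw [h1, h2, ← conj_displaceFun_vacuumFun_mul]
    rfl
  rw [integral_congr_ae this, integral_const_mul, integral_cexp_quadratic (by simp)]
  have hpi : ((Real.pi ^ (-(1 / 2) : ℝ) : ℝ) : ℂ) * ((Real.pi : ℂ) / -(-1)) ^ (1 / 2 : ℂ) = 1 := by
    rw [Complex.ofReal_cpow Real.pi_pos.le, neg_neg, div_one]
    push_cast
    rw [← Complex.cpow_add _ _ (by exact_mod_cast Real.pi_ne_zero)]
    simp
  rw [← mul_assoc, hpi, one_mul]
  congr 1
  have hn : ∀ z : ℂ, (‖z‖ : ℂ) ^ 2 = z.re ^ 2 + z.im ^ 2 := fun z => by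
    rw [← Complex.ofReal_pow, Complex.sq_norm, Complex.normSq_apply]; push_cast; ring
  have hα : starRingEnd ℂ α = α.re - α.im * Complex.I := by
    apply Complex.ext <;> simp
  have hβ := (Complex.re_add_im β).symm
  rw [hn, hn, mul_pow, h2, hα]
  generalize β.re = a at *
  generalize β.im = b at *
  rw [hβ]
  linear_combination ((α.im : ℂ) ^ 2 / 2 + b ^ 2 / 2) * Complex.I_sq

lemma norm_coherentVec (α : ℂ) : ‖coherentVec α‖ = 1 := by
  have h := inner_self_eq_norm_sq_to_K (𝕜 := ℂ) (coherentVec α)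
  rw [inner_coherentVec, ← Complex.normSq_eq_conj_mul_self, ← Complex.sq_norm] at h
  rw [show (((‖α‖ ^ 2 : ℝ) : ℂ) - (‖α‖ : ℂ) ^ 2 / 2 - (‖α‖ : ℂ) ^ 2 / 2) = 0 by push_cast; ring,
    Complex.exp_zero] at h
  have h' : (1 : ℝ) = ‖coherentVec α‖ ^ 2 := by
    exact Complex.ofReal_injective (h.trans (by push_cast; rfl))
  nlinarith [norm_nonneg (coherentVec α)]

lemma norm_sq_inner_coherentVec (α β : ℂ) :
    ‖(inner ℂ (coherentVec α) (coherentVec β) : ℂ)‖ ^ 2 = Real.exp (-‖α - β‖ ^ 2) := by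
  rw [inner_coherentVec, Complex.norm_exp, ← Real.exp_nat_mul]
  congr 1
  rw [← Complex.ofReal_pow, ← Complex.ofReal_pow]
  simp only [Complex.sq_norm, Complex.normSq_apply, Complex.sub_re, Complex.mul_re,
    Complex.conj_re, Complex.conj_im, Complex.sub_im, Complex.div_ofNat_re, Complex.ofReal_re]
  push_cast
  ring

/-- For unit vectors `‖g x - g y‖² = 2 - 2 Re ⟪g x, g y⟫`, so continuity can be read off the
explicit overlaps. -/
lemma continuous_of_continuous_inner {X E : Type*} [TopologicalSpace X] [NormedAddCommGroup E]
    [InnerProductSpace ℂ E] {g : X → E} (hg : ∀ x, ‖g x‖ = 1)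
    (hc : ∀ y, Continuous fun x => (inner ℂ (g x) (g y) : ℂ)) : Continuous g := by
  rw [continuous_iff_continuousAt]
  intro y
  rw [ContinuousAt, tendsto_iff_norm_sub_tendsto_zero]
  have h1 : ∀ x, ‖g x - g y‖ = √(2 - 2 * (inner ℂ (g x) (g y) : ℂ).re) := fun x => by
    rw [← Real.sqrt_sq (norm_nonneg (g x - g y)), norm_sub_sq (𝕜 := ℂ) (g x), hg, hg]
    congr 1
    simp only [RCLike.re_to_complex]
    ring
  have h2 : Continuous fun x => √(2 - 2 * (inner ℂ (g x) (g y) : ℂ).re) := by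
    have := hc y
    fun_prop
  simp only [h1]
  refine (h2.tendsto' y 0 ?_)
  rw [← h1, sub_self, norm_zero]

lemma continuous_coherentVec : Continuous coherentVec :=
  continuous_of_continuous_inner norm_coherentVec fun y => by
    simp only [inner_coherentVec]
    fun_prop

lemma displace_rankOne (α : ℂ) (u : Mode) :
    displace α (InnerProductSpace.rankOne ℂ u u) =
      InnerProductSpace.rankOne ℂ (displacement α u) (displacement α u) := by
  ext1 z
  simp [displace, ContinuousLinearMap.adjoint_inner_right]

/-- The Weyl relation: displacements compose up to the phase `exp (i Im (α β*))`, which drops out of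
the projectors. -/
lemma displacement_coherentVec (α β : ℂ) : ∃ c : ℂ, ‖c‖ = 1 ∧
    displacement α (coherentVec β) = c • coherentVec (α + β) := by
  refine ⟨Complex.exp (((α.im * β.re - α.re * β.im : ℝ) : ℂ) * Complex.I),
    Complex.norm_exp_ofReal_mul_I _, ?_⟩
  apply Lp.ext
  have h1 : displacement α (coherentVec β) =ᵐ[volume]
      displaceFun α (displaceFun β vacuumFun) :=
    (MemLp.coeFn_toLp (displaceFun_memLp α (Lp.memLp (coherentVec β)))).trans
      (displaceFun_congr α (coherentVec_ae β))
  filter_upwards [h1, Lp.coeFn_smul (Complex.exp (((α.im * β.re - α.re * β.im : ℝ) : ℂ) *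
    Complex.I)) (coherentVec (α + β)), coherentVec_ae (α + β)] with x h2 h3 h4
  rw [h2, h3, Pi.smul_apply, h4]
  have h2' : ((√2 : ℝ) : ℂ) ^ 2 = 2 := by
    rw [← Complex.ofReal_pow, Real.sq_sqrt zero_le_two]; norm_num
  simp only [displaceFun, smul_eq_mul, ← mul_assoc, ← Complex.exp_add, Complex.add_re,
    Complex.add_im]
  congr 2
  · push_cast
    linear_combination ((α.im : ℂ) * β.re / 2 - α.re * β.im / 2) * Complex.I * h2'
  · ring

lemma displace_coherentState (α β : ℂ) :
    displace α (coherentState β) = coherentState (α + β) := by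
  obtain ⟨c, hc, h⟩ := displacement_coherentVec α β
  rw [coherentState, displace_rankOne, h]
  ext1 z
  simp only [coherentState, InnerProductSpace.rankOne_apply, inner_smul_left, smul_smul]
  congr 1
  have : (starRingEnd ℂ) c * c = 1 := by
    rw [← Complex.normSq_eq_conj_mul_self, ← Complex.sq_norm, hc]; norm_num
  linear_combination (inner ℂ (coherentVec (α + β)) z) * this

lemma continuous_coherentState : Continuous coherentState := by
  have h := continuous_coherentVec
  have h2 : Continuous fun α => innerSL ℂ (coherentVec α) := (innerSL ℂ).continuous.comp h
  exact ((ContinuousLinearMap.smulRightL ℂ Mode Mode).continuous.comp h2).clm_apply h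

lemma norm_coherentState (α : ℂ) : ‖coherentState α‖ = 1 := by
  rw [coherentState, InnerProductSpace.norm_rankOne, norm_coherentVec, one_mul]

lemma integrable_smul_coherentState {ν : Measure ℂ} {P : ℂ → ℂ} (hP : Integrable P ν)
    {g : ℂ → ℂ} (hg : Continuous g) : Integrable (fun α => P α • coherentState (g α)) ν := by
  refine hP.mono (hP.1.smul (continuous_coherentState.comp hg).aestronglyMeasurable)
    (Filter.Eventually.of_forall fun α => ?_)
  rw [norm_smul, norm_coherentState, mul_one]

lemma inner_coherentState (ψ : Mode) (α : ℂ) : (inner ℂ ψ (coherentState α ψ) : ℂ) =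
    ((‖(inner ℂ ψ (coherentVec α) : ℂ)‖ ^ 2 : ℝ) : ℂ) := by
  rw [coherentState, InnerProductSpace.rankOne_apply, inner_smul_right,
    ← inner_conj_symm (coherentVec α) ψ, ← Complex.normSq_eq_conj_mul_self, Complex.sq_norm]

lemma inner_integral_apply {X : Type*} [MeasurableSpace X] {ν : Measure X} {T : X → Op}
    (hT : Integrable T ν) (ψ φ : Mode) :
    (inner ℂ ψ ((∫ a, T a ∂ν) φ) : ℂ) = ∫ a, inner ℂ ψ (T a φ) ∂ν :=
  (((innerSL ℂ ψ).comp (ContinuousLinearMap.apply ℂ Mode φ)).integral_comp_comm hT).symm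

/-! ### Uniqueness of the P-representation -/

lemma integrable_gaussian : Integrable fun v : ℂ => Real.exp (-‖v‖ ^ 2) := by
  have := (GaussianFourier.integrable_cexp_neg_mul_sq_norm_add (V := ℂ) (b := 1) (by simp) 0 0).norm
  refine this.congr (Filter.Eventually.of_forall fun v => ?_)
  simp only [Complex.norm_exp]
  congr 1
  simp [← Complex.ofReal_pow]

/-- The convolution theorem for `ν` and a Gaussian, by Fubini and translation. -/
lemma integral_gaussian_mul_charFun (ν : Measure ℂ) [IsFiniteMeasure ν] (ξ : ℂ) :
    ∫ β, Complex.exp (((inner ℝ β ξ : ℝ) : ℂ) * Complex.I) *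
      ((∫ α, Real.exp (-‖β - α‖ ^ 2) ∂ν : ℝ) : ℂ) =
    (∫ v : ℂ, Complex.exp (((inner ℝ v ξ : ℝ) : ℂ) * Complex.I) * (Real.exp (-‖v‖ ^ 2) : ℝ)) *
      charFun ν ξ := by
  have hF : Integrable (Function.uncurry fun (α β : ℂ) =>
      Complex.exp (((inner ℝ β ξ : ℝ) : ℂ) * Complex.I) * (Real.exp (-‖β - α‖ ^ 2) : ℝ))
      (ν.prod volume) := by
    have h1 : Integrable (fun z : ℂ × ℂ => (Real.exp (-‖z.2 - z.1‖ ^ 2) : ℝ)) (ν.prod volume) :=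
      (measurePreserving_prod_sub ν volume).integrable_comp_of_integrable
        (integrable_gaussian.comp_snd ν)
    refine h1.mono (Continuous.aestronglyMeasurable ?_) (Filter.Eventually.of_forall fun z => ?_)
    · simp only [Function.uncurry_def]
      fun_prop
    · simp only [Function.uncurry, norm_mul, Complex.norm_exp_ofReal_mul_I, one_mul,
        Complex.norm_real, le_refl]
  calc _ = ∫ β, ∫ α, Complex.exp (((inner ℝ β ξ : ℝ) : ℂ) * Complex.I) *
      (Real.exp (-‖β - α‖ ^ 2) : ℝ) ∂ν := by
        refine integral_congr_ae (Filter.Eventually.of_forall fun β => ?_)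
        simp only
        rw [integral_const_mul, integral_complex_ofReal]
    _ = ∫ α, (∫ β : ℂ, Complex.exp (((inner ℝ β ξ : ℝ) : ℂ) * Complex.I) *
      (Real.exp (-‖β - α‖ ^ 2) : ℝ)) ∂ν := (integral_integral_swap hF).symm
    _ = ∫ α, (∫ v : ℂ, Complex.exp (((inner ℝ v ξ : ℝ) : ℂ) * Complex.I) *
        (Real.exp (-‖v‖ ^ 2) : ℝ)) * Complex.exp (((inner ℝ α ξ : ℝ) : ℂ) * Complex.I) ∂ν := by
        refine integral_congr_ae (Filter.Eventually.of_forall fun α => ?_)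
        simp only
        rw [← integral_add_right_eq_self _ α, ← integral_mul_const]
        refine integral_congr_ae (Filter.Eventually.of_forall fun v => ?_)
        simp only [add_sub_cancel_right, inner_add_left, Complex.ofReal_add, add_mul,
          Complex.exp_add]
        ring
    _ = _ := by rw [integral_const_mul, charFun_apply]

lemma gaussian_fourier_ne_zero (ξ : ℂ) :
    (∫ v : ℂ, Complex.exp (((inner ℝ v ξ : ℝ) : ℂ) * Complex.I) * (Real.exp (-‖v‖ ^ 2) : ℝ)) ≠ 0 := by
  have h := GaussianFourier.integral_cexp_neg_mul_sq_norm_add (V := ℂ) (b := 1) (by simp)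
    Complex.I ξ
  have h2 : ∀ v : ℂ, Complex.exp (((inner ℝ v ξ : ℝ) : ℂ) * Complex.I) *
      (Real.exp (-‖v‖ ^ 2) : ℝ) = Complex.exp (-1 * (‖v‖ : ℂ) ^ 2 + Complex.I * (inner ℝ ξ v : ℝ)) :=
    fun v => by
    rw [Complex.ofReal_exp, ← Complex.exp_add, real_inner_comm]
    congr 1
    push_cast
    ring
  simp only [h2]
  rw [h]
  refine mul_ne_zero ?_ (Complex.exp_ne_zero _)
  rw [Complex.finrank_real_complex]
  simp [Real.pi_ne_zero]

lemma measure_eq_of_husimi_eq {ν₁ ν₂ : Measure ℂ} [IsFiniteMeasure ν₁] [IsFiniteMeasure ν₂]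
    (h : ∀ β, ∫ α, Real.exp (-‖β - α‖ ^ 2) ∂ν₁ = ∫ α, Real.exp (-‖β - α‖ ^ 2) ∂ν₂) :
    ν₁ = ν₂ := by
  refine Measure.ext_of_charFun (funext fun ξ => ?_)
  have h1 := integral_gaussian_mul_charFun ν₁ ξ
  simp only [h] at h1
  rw [integral_gaussian_mul_charFun ν₂ ξ] at h1
  exact (mul_left_cancel₀ (gaussian_fourier_ne_zero ξ) h1).symm

lemma integral_smul_coherentState_husimi {ν : Measure ℂ} {P : ℂ → ℝ} (hP : Integrable P ν)
    (β : ℂ) :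
    (inner ℂ (coherentVec β) ((∫ α, ((P α : ℝ) : ℂ) • coherentState α ∂ν) (coherentVec β)) : ℂ) =
      ((∫ α, P α * Real.exp (-‖β - α‖ ^ 2) ∂ν : ℝ) : ℂ) := by
  rw [inner_integral_apply (T := fun α => ((P α : ℝ) : ℂ) • coherentState α)
    (integrable_smul_coherentState hP.ofReal continuous_id), ← integral_complex_ofReal]
  refine integral_congr_ae (Filter.Eventually.of_forall fun α => ?_)
  simp only [smul_apply, inner_smul_right, inner_coherentState, norm_sq_inner_coherentVec]
  push_cast
  rfl

lemma integrable_exp_neg_norm_sub_sq {ν : Measure ℂ} [IsFiniteMeasure ν] (β : ℂ) :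
    Integrable (fun α => Real.exp (-‖β - α‖ ^ 2)) ν := by
  refine Integrable.of_bound (C := 1) (Continuous.aestronglyMeasurable (by fun_prop))
    (Filter.Eventually.of_forall fun α => ?_)
  rw [Real.norm_eq_abs, abs_of_nonneg (Real.exp_pos _).le, Real.exp_le_one_iff]
  simp only [Left.neg_nonpos_iff]
  positivity

/-- If `ρ` were also the mixture over `μ`, equality of Husimi functions would give `P₊ = μ + P₋` as
positive measures. Evaluating on `Ω₋`, where `P₊` has no mass, forces `P₋` to have none there
either, contrary to its strict positivity on a set of positive area. -/
lemma HasNegativePFunction.not_isClassicalState {ρ : Op} (h : HasNegativePFunction ρ) :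
    ¬ IsClassicalState ρ := by
  rintro ⟨-, μ, hμ, hρμ⟩
  obtain ⟨Ωp, Ωm, Pp, Pm, hΩp, hΩm, hd, hvol, hPp, hPm, hip, him, hρ⟩ := h
  have key : ∀ {A : Set ℂ} {P : ℂ → ℝ}, MeasurableSet A → (∀ α ∈ A, 0 < P α) →
      IntegrableOn P A phaseMeasure →
      IsFiniteMeasure ((phaseMeasure.restrict A).withDensity fun α => ENNReal.ofReal (P α)) ∧
      ∀ g : ℂ → ℝ, ∫ α, g α ∂((phaseMeasure.restrict A).withDensity
        fun α => ENNReal.ofReal (P α)) = ∫ α in A, P α * g α ∂phaseMeasure := by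
    intro A P hA hP hi
    refine ⟨isFiniteMeasure_withDensity_ofReal hi.2, fun g => ?_⟩
    rw [integral_withDensity_eq_integral_toReal_smul₀ hi.1.aemeasurable.ennreal_ofReal
      (Filter.Eventually.of_forall fun _ => ENNReal.ofReal_lt_top)]
    refine setIntegral_congr_fun hA fun α hα => ?_
    simp only [ENNReal.toReal_ofReal (hP α hα).le, smul_eq_mul]
  obtain ⟨hf1, h1⟩ := key hΩp hPp hip
  obtain ⟨hf2, h2⟩ := key hΩm hPm him
  have heq : (phaseMeasure.restrict Ωp).withDensity (fun α => ENNReal.ofReal (Pp α)) =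
      μ + (phaseMeasure.restrict Ωm).withDensity (fun α => ENNReal.ofReal (Pm α)) := by
    refine measure_eq_of_husimi_eq fun β => ?_
    rw [integral_add_measure (integrable_exp_neg_norm_sub_sq β) (integrable_exp_neg_norm_sub_sq β),
      h1, h2]
    have h3 := integral_smul_coherentState_husimi (integrable_const (μ := μ) (1 : ℝ)) β
    simp only [Complex.ofReal_one, one_smul, one_mul] at h3
    rw [← hρμ, hρ, sub_apply, inner_sub_right,
      integral_smul_coherentState_husimi hip, integral_smul_coherentState_husimi him] at h3
    rw [← sub_eq_iff_eq_add]
    exact_mod_cast h3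
  have hz : ((phaseMeasure.restrict Ωm).withDensity (fun α => ENNReal.ofReal (Pm α))) Ωm = 0 := by
    have h3 : ((phaseMeasure.restrict Ωp).withDensity (fun α => ENNReal.ofReal (Pp α))) Ωm = 0 := by
      refine withDensity_absolutelyContinuous _ _ ?_
      rw [Measure.restrict_apply hΩm, hd.symm.inter_eq, measure_empty]
    rw [heq, Measure.add_apply, add_eq_zero] at h3
    exact h3.2
  rw [withDensity_apply _ hΩm, Measure.restrict_restrict hΩm, Set.inter_self,
    setLIntegral_eq_zero_iff' hΩm him.1.aemeasurable.ennreal_ofReal] at hz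
  have hm : phaseMeasure Ωm = 0 := by
    refine measure_mono_null (fun α hα => ?_) (ae_iff.1 hz)
    simp only [Classical.not_imp, Set.mem_ofPred_eq, ENNReal.ofReal_eq_zero, not_le]
    exact ⟨hα, hPm α hα⟩
  rw [phaseMeasure, Measure.smul_apply, smul_eq_mul, mul_eq_zero, ENNReal.ofReal_eq_zero] at hm
  rcases hm with hm | hm
  · exact hm.not_gt (inv_pos.2 Real.pi_pos)
  · exact hvol.ne' hm

/-! ### Domination of a disc by an annulus -/

/-- The mean value property applied to the entire function `g²`. -/
lemma two_pi_mul_enorm_sq_le_lintegral_circle {g : ℂ → ℂ} (hg : Differentiable ℂ g) (c : ℂ)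
    (r : ℝ) : ENNReal.ofReal (2 * Real.pi) * ‖g c‖ₑ ^ 2 ≤
      ∫⁻ θ in Set.Ioo (-Real.pi) Real.pi, ‖g (circleMap c r θ)‖ₑ ^ 2 := by
  have h1 : Real.circleAverage (fun z => g z ^ 2) c r = g c ^ 2 :=
    ((hg.pow 2).diffContOnCl).circleAverage
  rw [Real.circleAverage_eq_integral_add (-Real.pi), intervalIntegral.integral_comp_add_right
    (fun θ => g (circleMap c r θ) ^ 2), zero_add, show 2 * Real.pi + -Real.pi = Real.pi by ring,
    intervalIntegral.integral_of_le (by linarith [Real.pi_pos])] at h1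
  have h2 : (2 * Real.pi) • g c ^ 2 =
      ∫ θ in Set.Ioc (-Real.pi) Real.pi, g (circleMap c r θ) ^ 2 := by
    rw [← h1, smul_inv_smul₀ (by positivity)]
  calc ENNReal.ofReal (2 * Real.pi) * ‖g c‖ₑ ^ 2 = ‖(2 * Real.pi) • g c ^ 2‖ₑ := by
        rw [enorm_smul, enorm_pow, Real.enorm_eq_ofReal (by positivity)]
    _ ≤ ∫⁻ θ in Set.Ioc (-Real.pi) Real.pi, ‖g (circleMap c r θ) ^ 2‖ₑ := by
        rw [h2]
        exact enorm_integral_le_lintegral_enorm _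
    _ = _ := by
        simp only [enorm_pow]
        exact setLIntegral_congr Ioo_ae_eq_Ioc.symm

/-- The circle estimate is integrated over radii in `(2, 3)`, an interval of length one, and the
polar Jacobian is at least one there. For `|c| < 1` this annulus stays inside `1 ≤ |z| < 4`. -/
lemma two_pi_mul_enorm_sq_le_lintegral_annulus {g : ℂ → ℂ} (hg : Differentiable ℂ g) (c : ℂ) :
    ENNReal.ofReal (2 * Real.pi) * ‖g c‖ₑ ^ 2 ≤
      ∫⁻ z in {z | 2 < ‖z - c‖ ∧ ‖z - c‖ < 3}, ‖g z‖ₑ ^ 2 := by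
  have hgc := hg.continuous
  have hA : MeasurableSet {z : ℂ | 2 < ‖z - c‖ ∧ ‖z - c‖ < 3} :=
    ((isOpen_lt (by fun_prop) (by fun_prop)).and
      (isOpen_lt (by fun_prop) (by fun_prop))).measurableSet
  rw [← lintegral_indicator hA, ← lintegral_add_right_eq_self _ c,
    ← Complex.lintegral_comp_polarCoord_symm]
  have h1 : ∀ p ∈ Set.Ioo (2 : ℝ) 3 ×ˢ Set.Ioo (-Real.pi) Real.pi,
      ‖g (circleMap c p.1 p.2)‖ₑ ^ 2 ≤ ENNReal.ofReal p.1 •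
        Set.indicator {z : ℂ | 2 < ‖z - c‖ ∧ ‖z - c‖ < 3} (fun z => ‖g z‖ₑ ^ 2)
          (Complex.polarCoord.symm p + c) := fun p hp => by
    have hp1 : 2 < p.1 := hp.1.1
    have h2 : Complex.polarCoord.symm p + c = circleMap c p.1 p.2 := by
      rw [Complex.polarCoord_symm_apply, circleMap, Complex.exp_mul_I]
      push_cast
      ring
    rw [Set.indicator_of_mem, h2]
    · refine le_mul_of_one_le_left' (ENNReal.one_le_ofReal.2 (by linarith))
    · change 2 < ‖_‖ ∧ ‖_‖ < 3
      rw [add_sub_cancel_right, Complex.norm_polarCoord_symm, abs_of_pos (by linarith)]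
      exact hp.1
  have hS : MeasurableSet (Set.Ioo (2 : ℝ) 3 ×ˢ Set.Ioo (-Real.pi) Real.pi) :=
    measurableSet_Ioo.prod measurableSet_Ioo
  calc ENNReal.ofReal (2 * Real.pi) * ‖g c‖ₑ ^ 2
      = ∫⁻ _ in Set.Ioo (2 : ℝ) 3, ENNReal.ofReal (2 * Real.pi) * ‖g c‖ₑ ^ 2 := by
        rw [setLIntegral_const, Real.volume_Ioo]
        norm_num
    _ ≤ ∫⁻ r in Set.Ioo (2 : ℝ) 3, ∫⁻ θ in Set.Ioo (-Real.pi) Real.pi,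
          ‖g (circleMap c r θ)‖ₑ ^ 2 :=
        lintegral_mono fun r => two_pi_mul_enorm_sq_le_lintegral_circle hg c r
    _ = ∫⁻ p in Set.Ioo (2 : ℝ) 3 ×ˢ Set.Ioo (-Real.pi) Real.pi,
          ‖g (circleMap c p.1 p.2)‖ₑ ^ 2 := by
        rw [Measure.volume_eq_prod, ← Measure.prod_restrict, lintegral_prod]
        refine Measurable.aemeasurable ?_
        have : Continuous fun p : ℝ × ℝ => g (circleMap c p.1 p.2) := by
          unfold circleMap
          fun_prop
        exact this.measurable.enorm.pow_const 2
    _ ≤ ∫⁻ p in Set.Ioo (2 : ℝ) 3 ×ˢ Set.Ioo (-Real.pi) Real.pi, ENNReal.ofReal p.1 •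
        Set.indicator {z : ℂ | 2 < ‖z - c‖ ∧ ‖z - c‖ < 3} (fun z => ‖g z‖ₑ ^ 2)
          (Complex.polarCoord.symm p + c) := setLIntegral_mono' hS h1
    _ ≤ _ := by
        refine lintegral_mono_set ?_
        rw [polarCoord_target]
        exact Set.prod_mono (fun r hr => lt_trans two_pos hr.1) le_rfl

/-- The Bargmann function of `ψ` is entire. -/
lemma differentiable_bargmann (ψ : Mode) : Differentiable ℂ fun α : ℂ =>
    Complex.exp ((‖α‖ : ℂ) ^ 2 / 2) * (inner ℂ ψ (coherentVec α) : ℂ) := by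
  -- The vectors with entire Bargmann function form a subspace that contains the coherent vectors
  -- and is closed, because norm convergence of `ψ` gives locally uniform convergence of the
  -- functions.
  let W : Submodule ℂ Mode :=
    { carrier := {ψ | Differentiable ℂ fun α : ℂ =>
        Complex.exp ((‖α‖ : ℂ) ^ 2 / 2) * (inner ℂ ψ (coherentVec α) : ℂ)}
      add_mem' := fun {ψ φ} h1 h2 => by
        change Differentiable ℂ _
        simp only [inner_add_left, mul_add]
        exact Differentiable.add h1 h2
      zero_mem' := by
        change Differentiable ℂ _
        simp
      smul_mem' := fun c ψ h => by
        change Differentiable ℂ _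
        simp only [inner_smul_left, mul_left_comm _ ((starRingEnd ℂ) c)]
        exact Differentiable.const_mul h _ }
  have hmem : ∀ β, coherentVec β ∈ W := fun β => by
    change Differentiable ℂ _
    simp only [inner_coherentVec, ← Complex.exp_add]
    have : ∀ α : ℂ, (‖α‖ : ℂ) ^ 2 / 2 + ((starRingEnd ℂ) β * α - (‖β‖ : ℂ) ^ 2 / 2 -
      (‖α‖ : ℂ) ^ 2 / 2) = (starRingEnd ℂ) β * α - (‖β‖ : ℂ) ^ 2 / 2 := fun α => by ring
    simp only [this]
    fun_prop
  have hclosed : IsClosed (W : Set Mode) := by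
    refine IsSeqClosed.isClosed fun ψs ψ hψs hlim => ?_
    change Differentiable ℂ _
    rw [← differentiableOn_univ]
    refine TendstoLocallyUniformlyOn.differentiableOn (φ := Filter.atTop)
      (F := fun n α => Complex.exp ((‖α‖ : ℂ) ^ 2 / 2) * (inner ℂ (ψs n) (coherentVec α) : ℂ))
      ?_ (Filter.Eventually.of_forall fun n => (hψs n).differentiableOn) isOpen_univ
    rw [tendstoLocallyUniformlyOn_univ, tendstoLocallyUniformly_iff_forall_isCompact]
    intro S hS
    obtain ⟨M, hM⟩ := hS.exists_bound_of_continuousOn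
      (f := fun α : ℂ => Complex.exp ((‖α‖ : ℂ) ^ 2 / 2)) (by fun_prop)
    have hM' : 0 < |M| + 1 := by positivity
    rw [Metric.tendstoUniformlyOn_iff]
    intro ε hε
    have := (tendsto_iff_norm_sub_tendsto_zero.1 hlim).eventually_lt_const (div_pos hε hM')
    filter_upwards [this] with n hn α hα
    rw [dist_comm, dist_eq_norm, ← mul_sub, ← inner_sub_left, norm_mul]
    have h1 := norm_inner_le_norm (𝕜 := ℂ) (ψs n - ψ) (coherentVec α)
    rw [norm_coherentVec, mul_one] at h1
    have h2 : ‖Complex.exp ((‖α‖ : ℂ) ^ 2 / 2)‖ ≤ |M| + 1 := by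
      linarith [hM α hα, le_abs_self M]
    calc _ ≤ (|M| + 1) * ‖ψs n - ψ‖ := mul_le_mul h2 h1 (norm_nonneg _) hM'.le
      _ < (|M| + 1) * (ε / (|M| + 1)) := by gcongr
      _ = ε := by field_simp
  -- A vector orthogonal to `W` has Bargmann function zero, which is entire, so it lies in `W` as
  -- well. Totality of the coherent vectors is not needed.
  have hperp : Wᗮ = ⊥ := by
    rw [eq_bot_iff]
    intro φ hφ
    have hφW : φ ∈ W := by
      change Differentiable ℂ _
      have : ∀ α, (inner ℂ φ (coherentVec α) : ℂ) = 0 := fun α =>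
        Submodule.inner_left_of_mem_orthogonal (hmem α) hφ
      simp [this]
    exact (Submodule.orthogonal_disjoint W).le_bot ⟨hφW, hφ⟩
  have : CompleteSpace W := hclosed.completeSpace_coe
  have htop : W = ⊤ := (Submodule.orthogonal_eq_bot_iff (K := W)).1 hperp
  exact (htop ▸ Submodule.mem_top : ψ ∈ W)

lemma enorm_bargmann (ψ : Mode) (α : ℂ) :
    ‖Complex.exp ((‖α‖ : ℂ) ^ 2 / 2) * (inner ℂ ψ (coherentVec α) : ℂ)‖ₑ ^ 2 =
      ENNReal.ofReal (Real.exp (‖α‖ ^ 2)) * ‖(inner ℂ ψ (coherentVec α) : ℂ)‖ₑ ^ 2 := by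
  rw [enorm_mul, mul_pow, ← enorm_pow, ← Complex.exp_nat_mul]
  congr 1
  rw [← ofReal_norm, Complex.norm_exp]
  congr 2
  rw [← Complex.ofReal_pow]
  simp only [Nat.cast_ofNat, Complex.mul_re, Complex.re_ofNat, Complex.im_ofNat, zero_mul, sub_zero,
    Complex.div_ofNat_re, Complex.ofReal_re]
  ring

/-- Passing to the Bargmann function costs the weight `exp (|α|²)`, which is at least one on the
disc and at most `exp 16` for `|α| < 4`. -/
lemma lintegral_disc_le_annulus (ψ : Mode) :
    ∫⁻ α in Metric.ball 0 1, ‖(inner ℂ ψ (coherentVec α) : ℂ)‖ₑ ^ 2 ≤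
      ENNReal.ofReal (Real.exp 16) *
        ∫⁻ α in Metric.ball 0 4 \ Metric.ball 0 1, ‖(inner ℂ ψ (coherentVec α) : ℂ)‖ₑ ^ 2 := by
  set g : ℂ → ℂ := fun α => Complex.exp ((‖α‖ : ℂ) ^ 2 / 2) * (inner ℂ ψ (coherentVec α) : ℂ)
  have hg : Differentiable ℂ g := differentiable_bargmann ψ
  set I := ∫⁻ α in Metric.ball 0 4 \ Metric.ball 0 1, ‖(inner ℂ ψ (coherentVec α) : ℂ)‖ₑ ^ 2
  have hpi : ENNReal.ofReal Real.pi * (ENNReal.ofReal (2 * Real.pi))⁻¹ ≤ 1 := by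
    rw [← div_eq_mul_inv]
    refine ENNReal.div_le_of_le_mul ?_
    rw [one_mul]
    exact ENNReal.ofReal_le_ofReal (by linarith [Real.pi_pos])
  have h0 : ENNReal.ofReal (2 * Real.pi) ≠ 0 := by
    simp [Real.pi_pos]
  have h1 : ∀ α ∈ Metric.ball (0 : ℂ) 1, ‖(inner ℂ ψ (coherentVec α) : ℂ)‖ₑ ^ 2 ≤
      (ENNReal.ofReal (2 * Real.pi))⁻¹ * (ENNReal.ofReal (Real.exp 16) * I) := fun α hα => by
    rw [← ENNReal.mul_le_iff_le_inv h0 ENNReal.ofReal_ne_top]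
    rw [mem_ball_zero_iff] at hα
    calc ENNReal.ofReal (2 * Real.pi) * ‖(inner ℂ ψ (coherentVec α) : ℂ)‖ₑ ^ 2
        ≤ ENNReal.ofReal (2 * Real.pi) * ‖g α‖ₑ ^ 2 := by
          rw [enorm_bargmann]
          gcongr
          refine le_mul_of_one_le_left' (ENNReal.one_le_ofReal.2 (Real.one_le_exp (by positivity)))
      _ ≤ _ := two_pi_mul_enorm_sq_le_lintegral_annulus hg α
      _ ≤ ∫⁻ z in Metric.ball 0 4 \ Metric.ball 0 1, ‖g z‖ₑ ^ 2 := by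
          refine lintegral_mono_set fun z hz => ?_
          have h3 := norm_sub_le z α
          have h4 := norm_le_norm_sub_add z α
          have h5 : ‖z‖ < 4 := by linarith [hz.2]
          have h6 : 1 ≤ ‖z‖ := by linarith [hz.1]
          simp [h5, h6]
      _ ≤ ∫⁻ z in Metric.ball 0 4 \ Metric.ball 0 1,
          ENNReal.ofReal (Real.exp 16) * ‖(inner ℂ ψ (coherentVec z) : ℂ)‖ₑ ^ 2 := by
          refine setLIntegral_mono' (measurableSet_ball.diff measurableSet_ball) fun z hz => ?_
          rw [enorm_bargmann]
          have : ‖z‖ < 4 := mem_ball_zero_iff.1 hz.1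
          gcongr
          nlinarith [norm_nonneg z]
      _ = _ := lintegral_const_mul' _ _ ENNReal.ofReal_ne_top
  calc _ ≤ ∫⁻ _ in Metric.ball (0 : ℂ) 1,
        (ENNReal.ofReal (2 * Real.pi))⁻¹ * (ENNReal.ofReal (Real.exp 16) * I) :=
        setLIntegral_mono' measurableSet_ball h1
    _ = (ENNReal.ofReal Real.pi * (ENNReal.ofReal (2 * Real.pi))⁻¹) *
        (ENNReal.ofReal (Real.exp 16) * I) := by
        rw [setLIntegral_const, Complex.volume_ball]
        simp only [ENNReal.ofReal_one, one_pow, one_mul]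
        rw [show ((NNReal.pi : ℝ≥0) : ℝ≥0∞) = ENNReal.ofReal Real.pi from
          ENNReal.ofReal_coe_nnreal.symm]
        ring
    _ ≤ _ := mul_le_of_le_one_left' hpi

/-! ### Mixtures of coherent states and the smoothing channel -/

instance : SFinite phaseMeasure := by unfold phaseMeasure; infer_instance

instance : phaseMeasure.IsAddLeftInvariant := by unfold phaseMeasure; infer_instance

instance : phaseMeasure.IsAddRightInvariant := by unfold phaseMeasure; infer_instance

/-- `∫ P(α) |α⟩⟨α| d²α / π`. -/
def mix (P : ℂ → ℝ) : Op := ∫ α, ((P α : ℝ) : ℂ) • coherentState α ∂phaseMeasure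

lemma traceBound_coherentState (α : ℂ) : TraceBound (coherentState α) 1 := by
  have := traceBound_rankOne (coherentVec α) (coherentVec α)
  rwa [norm_coherentVec, one_mul] at this

lemma traceBound_mix {P : ℂ → ℝ} (hP : Integrable P phaseMeasure) :
    TraceBound (mix P) (∫ α, |P α| ∂phaseMeasure) := by
  refine TraceBound.integral (integrable_smul_coherentState hP.ofReal continuous_id) hP.abs
    fun α => ?_
  have := (traceBound_coherentState α).smul ((P α : ℝ) : ℂ)
  rwa [mul_one, Complex.norm_real] at this

/-- `displace α` as a continuous linear map. -/
def displaceL (α : ℂ) : Op →L[ℂ] Op :=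
  (ContinuousLinearMap.compL ℂ Mode Mode Mode (displacement α)).comp
    ((ContinuousLinearMap.compL ℂ Mode Mode Mode).flip
      (ContinuousLinearMap.adjoint (displacement α)))

lemma displaceL_apply (α : ℂ) (X : Op) : displaceL α X = displace α X := rfl

lemma displace_smul (α : ℂ) (c : ℂ) (X : Op) : displace α (c • X) = c • displace α X :=
  (displaceL α).map_smul c X

lemma displace_sub (α : ℂ) (X Y : Op) : displace α (X - Y) = displace α X - displace α Y :=
  (displaceL α).map_sub X Y

lemma displace_integral {X : Type*} [MeasurableSpace X] {ν : Measure X} {T : X → Op}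
    (hT : Integrable T ν) (β : ℂ) : displace β (∫ a, T a ∂ν) = ∫ a, displace β (T a) ∂ν :=
  ((displaceL β).integral_comp_comm hT).symm

lemma norm_displacement_le (α : ℂ) : ‖displacement α‖ ≤ 1 :=
  (displacementIsometry α).norm_toContinuousLinearMap_le

lemma TraceBound.displace {X : Op} {c : ℝ} (h : TraceBound X c) (α : ℂ) :
    TraceBound (displace α X) c :=
  h.conj (norm_displacement_le α)

lemma displace_integral_coherentState {ν : Measure ℂ} {P : ℂ → ℝ} (hP : Integrable P ν)
    {g : ℂ → ℂ} (hg : Continuous g) (β : ℂ) :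
    displace β (∫ α, ((P α : ℝ) : ℂ) • coherentState (g α) ∂ν) =
      ∫ α, ((P α : ℝ) : ℂ) • coherentState (β + g α) ∂ν := by
  rw [displace_integral (T := fun α => ((P α : ℝ) : ℂ) • coherentState (g α))
    (integrable_smul_coherentState hP.ofReal hg)]
  simp only [displace_smul, displace_coherentState]

lemma displace_mix {P : ℂ → ℝ} (hP : Integrable P phaseMeasure) (β : ℂ) :
    displace β (mix P) = ∫ α, ((P α : ℝ) : ℂ) • coherentState (β + α) ∂phaseMeasure :=
  displace_integral_coherentState hP continuous_id β

lemma continuous_displace_coherentState (α : ℂ) :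
    Continuous fun β => displace β (coherentState α) := by
  simp only [displace_coherentState]
  exact continuous_coherentState.comp (by fun_prop)

lemma continuous_displace_mix {P : ℂ → ℝ} (hP : Integrable P phaseMeasure) :
    Continuous fun β => displace β (mix P) := by
  simp only [displace_mix hP]
  refine continuous_of_dominated (bound := fun α => ‖P α‖)
    (fun β => (integrable_smul_coherentState hP.ofReal (by fun_prop)).1) (fun β => ?_) hP.norm ?_
  · refine Filter.Eventually.of_forall fun α => ?_
    rw [norm_smul, norm_coherentState, mul_one, Complex.norm_real]
  · refine Filter.Eventually.of_forall fun α => ?_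
    exact (continuous_coherentState.comp (continuous_add_const α)).const_smul ((P α : ℝ) : ℂ)

lemma norm_displace_le (β : ℂ) (X : Op) : ‖displace β X‖ ≤ ‖X‖ := by
  have h := norm_displacement_le β
  have h1 : ‖ContinuousLinearMap.adjoint (displacement β)‖ ≤ 1 := by
    rwa [LinearIsometryEquiv.norm_map]
  calc ‖displace β X‖ ≤ ‖displacement β‖ *
        (‖X‖ * ‖ContinuousLinearMap.adjoint (displacement β)‖) :=
        (ContinuousLinearMap.opNorm_comp_le _ _).trans (by
          gcongr; exact ContinuousLinearMap.opNorm_comp_le _ _)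
    _ ≤ 1 * (‖X‖ * 1) := by gcongr
    _ = ‖X‖ := by ring

section Channel

variable {f : ℂ → ℝ}

/-- Continuity of `β ↦ displace β X` in operator norm is not automatic for a bounded `X`; it
supplies the measurability that the Bochner integral requires. It is verified below for mixtures and
finite combinations of coherent states. -/
lemma integrable_smul_displace (hf : Integrable f phaseMeasure) {X : Op}
    (hX : Continuous fun β => displace β X) :
    Integrable (fun β => ((f β : ℝ) : ℂ) • displace β X) phaseMeasure := by
  refine (hf.ofReal (𝕜 := ℂ)).smul_bdd ‖X‖ hX.aestronglyMeasurable
    (Filter.Eventually.of_forall fun β => norm_displace_le β X)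

lemma smoothingChannel_sub (hf : Integrable f phaseMeasure) {X Y : Op}
    (hX : Continuous fun β => displace β X) (hY : Continuous fun β => displace β Y) :
    smoothingChannel f (X - Y) = smoothingChannel f X - smoothingChannel f Y := by
  simp only [smoothingChannel, displace_sub, smul_sub]
  exact integral_sub (integrable_smul_displace hf hX) (integrable_smul_displace hf hY)

lemma TraceBound.smoothingChannel (hf : Integrable f phaseMeasure) {X : Op} {c : ℝ}
    (hX : Continuous fun β => NoGo.displace β X) (h : TraceBound X c) :
    TraceBound (smoothingChannel f X) ((∫ β, |f β| ∂phaseMeasure) * c) := by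
  rw [← integral_mul_const]
  refine TraceBound.integral (integrable_smul_displace hf hX) (hf.abs.mul_const c) fun β => ?_
  have := (h.displace β).smul ((f β : ℝ) : ℂ)
  rwa [Complex.norm_real] at this

lemma smoothingChannel_vacuumState : smoothingChannel f vacuumState = mix f := by
  simp only [smoothingChannel, vacuumState, displace_coherentState, add_zero, mix]

/-- The smoothed P-function `P * f`. -/
def smooth (f P : ℂ → ℝ) (γ : ℂ) : ℝ := ∫ β, f β * P (γ - β) ∂phaseMeasure

lemma integrable_smooth_integrand (hf : Integrable f phaseMeasure) {P : ℂ → ℝ}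
    (hP : Integrable P phaseMeasure) :
    Integrable (fun z : ℂ × ℂ => f z.2 * P (z.1 - z.2)) (phaseMeasure.prod phaseMeasure) :=
  hf.convolution_integrand (ContinuousLinearMap.mul ℝ ℝ) hP

lemma integrable_smooth (hf : Integrable f phaseMeasure) {P : ℂ → ℝ}
    (hP : Integrable P phaseMeasure) : Integrable (smooth f P) phaseMeasure :=
  (integrable_smooth_integrand hf hP).integral_prod_left

lemma smoothingChannel_mix (hf : Integrable f phaseMeasure) {P : ℂ → ℝ}
    (hP : Integrable P phaseMeasure) : smoothingChannel f (mix P) = mix (smooth f P) := by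
  have h1 : ∀ β, displace β (mix P) =
      ∫ γ, ((P (γ - β) : ℝ) : ℂ) • coherentState γ ∂phaseMeasure := fun β => by
    rw [displace_mix hP, ← integral_sub_right_eq_self _ β]
    simp only [add_sub_cancel]
  have h2 : Integrable (Function.uncurry fun β γ => ((f β : ℝ) : ℂ) • ((P (γ - β) : ℝ) : ℂ) •
      coherentState γ) (phaseMeasure.prod phaseMeasure) := by
    have h3 := (integrable_smooth_integrand hf hP).swap
    refine h3.mono ?_ (Filter.Eventually.of_forall fun z => ?_)
    · have : (Function.uncurry fun β γ => ((f β : ℝ) : ℂ) • ((P (γ - β) : ℝ) : ℂ) •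
          coherentState γ) = fun z : ℂ × ℂ => ((f z.1 * P (z.2 - z.1) : ℝ) : ℂ) •
            coherentState z.2 := by
        ext1 z
        simp only [Function.uncurry, smul_smul, Complex.ofReal_mul]
      rw [this]
      exact (Complex.continuous_ofReal.comp_aestronglyMeasurable h3.1).smul
        (continuous_coherentState.comp continuous_snd).aestronglyMeasurable
    · simp only [Function.uncurry, norm_smul, norm_coherentState, mul_one, Complex.norm_real,
        Function.comp_apply, norm_mul, Prod.fst_swap, Prod.snd_swap, le_refl]
  calc smoothingChannel f (mix P)
      = ∫ β, (∫ γ, ((f β : ℝ) : ℂ) • ((P (γ - β) : ℝ) : ℂ) • coherentState γ ∂phaseMeasure)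
          ∂phaseMeasure := by
        simp only [smoothingChannel, h1, integral_smul]
    _ = ∫ γ, (∫ β, ((f β : ℝ) : ℂ) • ((P (γ - β) : ℝ) : ℂ) • coherentState γ ∂phaseMeasure)
          ∂phaseMeasure := integral_integral_swap h2
    _ = mix (smooth f P) := by
        refine integral_congr_ae (Filter.Eventually.of_forall fun γ => ?_)
        simp only [smul_smul, ← Complex.ofReal_mul]
        rw [integral_smul_const, integral_complex_ofReal]
        rfl

lemma mix_sub {P Q : ℂ → ℝ} (hP : Integrable P phaseMeasure) (hQ : Integrable Q phaseMeasure) :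
    mix (fun α => P α - Q α) = mix P - mix Q := by
  simp only [mix, Complex.ofReal_sub, sub_smul]
  exact integral_sub (integrable_smul_coherentState hP.ofReal continuous_id)
    (integrable_smul_coherentState hQ.ofReal continuous_id)

/-- The channel commutes with displacements, so information about the vacuum transfers to every
coherent state. -/
lemma displace_vacuumState_sub_smoothingChannel (hf : Integrable f phaseMeasure) (α : ℂ) :
    displace α (vacuumState - smoothingChannel f vacuumState) =
      coherentState α - smoothingChannel f (coherentState α) := by
  rw [smoothingChannel_vacuumState, displace_sub, displace_mix hf, vacuumState,
    displace_coherentState, add_zero]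
  simp only [smoothingChannel, displace_coherentState, add_comm]

end Channel

/-! ### Approximation by finite combinations of coherent states -/

/-- Approximation in trace norm with control of the `ℓ¹` norm of the coefficients. Continuity of `α
↦ coherentVec α` and dominated convergence drive it. -/
lemma exists_finite_approx {P : ℂ → ℝ} (hP : Integrable P phaseMeasure) {ε : ℝ} (hε : 0 < ε) :
    ∃ (s : Finset ℂ) (c : ℂ → ℝ), ∑ y ∈ s, |c y| ≤ ∫ α, |P α| ∂phaseMeasure ∧
      TraceBound (mix P - ∑ y ∈ s, ((c y : ℝ) : ℂ) • coherentState y) ε := by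
  -- The label `α` is discretised, not `P`: replacing `α` by `a n α` in the projector leaves
  -- finitely many coherent states, weighted by the integrals of `P` over the fibres of `a n`.
  let a : ℕ → SimpleFunc ℂ ℂ := fun n =>
    SimpleFunc.approxOn (fun α : ℂ => α) measurable_id Set.univ 0 (Set.mem_univ 0) n
  have ha : ∀ α, Filter.Tendsto (fun n => a n α) Filter.atTop (nhds α) := fun α =>
    SimpleFunc.tendsto_approxOn measurable_id (Set.mem_univ 0) (by simp)
  have hm : ∀ n, AEStronglyMeasurable
      (fun α => |P α| * (2 * ‖coherentVec α - coherentVec (a n α)‖)) phaseMeasure := fun n => by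
    refine hP.abs.1.mul (AEStronglyMeasurable.const_mul ?_ 2)
    exact ((continuous_coherentVec.aestronglyMeasurable).sub
      (continuous_coherentVec.comp_aestronglyMeasurable (a n).aestronglyMeasurable)).norm
  have hb : ∀ n α, ‖|P α| * (2 * ‖coherentVec α - coherentVec (a n α)‖)‖ ≤ 4 * |P α| :=
    fun n α => by
    rw [Real.norm_eq_abs, abs_of_nonneg (by positivity)]
    have := norm_sub_le (coherentVec α) (coherentVec (a n α))
    rw [norm_coherentVec, norm_coherentVec] at this
    nlinarith [abs_nonneg (P α)]
  have hlim : Filter.Tendsto (fun n => ∫ α, |P α| * (2 * ‖coherentVec α - coherentVec (a n α)‖)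
      ∂phaseMeasure) Filter.atTop (nhds 0) := by
    rw [← integral_zero ℂ ℝ (μ := phaseMeasure)]
    refine tendsto_integral_of_dominated_convergence (fun α => 4 * |P α|) hm (hP.abs.const_mul 4)
      (fun n => Filter.Eventually.of_forall (hb n)) (Filter.Eventually.of_forall fun α => ?_)
    have h1 := (continuous_coherentVec.tendsto α).comp (ha α)
    have h2 := ((tendsto_const_nhds (x := coherentVec α)).sub h1).norm
    simpa using (h2.const_mul 2).const_mul |P α|
  obtain ⟨n, hn⟩ := (hlim.eventually_le_const hε).exists
  have hd : Set.PairwiseDisjoint (↑(a n).range) fun y => (a n) ⁻¹' {y} := fun y _ z _ hyz =>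
    Set.disjoint_left.2 fun x hx hx' => hyz (hx.symm.trans hx')
  have hU : ⋃ y ∈ (a n).range, (a n) ⁻¹' {y} = Set.univ := by
    ext x
    simp
  have hi : Integrable (fun α => ((P α : ℝ) : ℂ) • coherentState (a n α)) phaseMeasure := by
    refine hP.mono ((Complex.continuous_ofReal.comp_aestronglyMeasurable hP.1).smul
      (continuous_coherentState.comp_aestronglyMeasurable (a n).aestronglyMeasurable))
      (Filter.Eventually.of_forall fun α => ?_)
    rw [norm_smul, norm_coherentState, mul_one, Complex.norm_real]
  have hsplit : ∫ α, ((P α : ℝ) : ℂ) • coherentState (a n α) ∂phaseMeasure =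
      ∑ y ∈ (a n).range, (((∫ α in (a n) ⁻¹' {y}, P α ∂phaseMeasure : ℝ)) : ℂ) •
        coherentState y := by
    rw [← setIntegral_univ, ← hU, integral_biUnion_finset _
      (fun y _ => (a n).measurableSet_fiber y) hd (fun y _ => hi.integrableOn)]
    refine Finset.sum_congr rfl fun y _ => ?_
    rw [setIntegral_congr_fun (g := fun α => ((P α : ℝ) : ℂ) • coherentState y)
      ((a n).measurableSet_fiber y) (fun α hα => by simp only [show a n α = y from hα]),
      integral_smul_const, integral_complex_ofReal]
  refine ⟨(a n).range, fun y => ∫ α in (a n) ⁻¹' {y}, P α ∂phaseMeasure, ?_, ?_⟩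
  · calc _ ≤ ∑ y ∈ (a n).range, ∫ α in (a n) ⁻¹' {y}, |P α| ∂phaseMeasure :=
          Finset.sum_le_sum fun y _ => abs_integral_le_integral_abs
      _ = _ := by
        rw [← integral_biUnion_finset _ (fun y _ => (a n).measurableSet_fiber y) hd
          (fun y _ => hP.abs.integrableOn), hU, setIntegral_univ]
  · have hi' : Integrable (fun α => ((P α : ℝ) : ℂ) • coherentState α) phaseMeasure :=
      integrable_smul_coherentState hP.ofReal continuous_id
    rw [← hsplit, mix, ← integral_sub hi' hi]
    refine (TraceBound.integral (hi'.sub hi)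
      (((hP.abs.const_mul 4)).mono' (hm n) (Filter.Eventually.of_forall (hb n)))
      fun α => ?_).mono hn
    rw [Pi.sub_apply, ← smul_sub]
    have := (traceBound_rankOne_self_sub (norm_coherentVec α) (norm_coherentVec (a n α))).smul
      ((P α : ℝ) : ℂ)
    rwa [Complex.norm_real] at this

/-- `F` annihilates `S - C(S)` for every finite combination `S` of coherent states, so only the
remainder `mix P - S` contributes. Exhibiting a small preimage `T` leaves the norm on the target
open, so the lemma serves both kinds of functional. -/
lemma exists_traceBound_of_vanishing {B : Type*} [AddCommGroup B] [Module ℂ B] {f : ℂ → ℝ}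
    (hf : Integrable f phaseMeasure) (F : Op →ₗ[ℂ] B)
    (hF : ∀ α, F (coherentState α - smoothingChannel f (coherentState α)) = 0)
    {P : ℂ → ℝ} (hP : Integrable P phaseMeasure) {ε : ℝ} (hε : 0 < ε) :
    ∃ T, TraceBound T ε ∧ F (mix P - smoothingChannel f (mix P)) = F T := by
  have hf0 : 0 ≤ ∫ β, |f β| ∂phaseMeasure := integral_nonneg fun _ => abs_nonneg _
  -- The map `X ↦ X - C(X)` enlarges trace bounds by at most `1 + ‖f‖₁`.
  have hδ : 0 < ε / (1 + ∫ β, |f β| ∂phaseMeasure) := by positivity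
  obtain ⟨s, c, -, hT⟩ := exists_finite_approx hP hδ
  have key : ∀ s : Finset ℂ, (Continuous fun β => displace β
        (∑ y ∈ s, ((c y : ℝ) : ℂ) • coherentState y)) ∧
      F ((∑ y ∈ s, ((c y : ℝ) : ℂ) • coherentState y) -
        smoothingChannel f (∑ y ∈ s, ((c y : ℝ) : ℂ) • coherentState y)) = 0 := fun s => by
    have h1 : ∀ β, displace β (∑ y ∈ s, ((c y : ℝ) : ℂ) • coherentState y) =
        ∑ y ∈ s, ((c y : ℝ) : ℂ) • displace β (coherentState y) := fun β => by
      simp only [← displaceL_apply, map_sum, map_smul]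
    constructor
    · simp only [h1]
      exact continuous_finsetSum _ fun y _ =>
        (continuous_displace_coherentState y).const_smul ((c y : ℝ) : ℂ)
    · have h2 : smoothingChannel f (∑ y ∈ s, ((c y : ℝ) : ℂ) • coherentState y) =
          ∑ y ∈ s, ((c y : ℝ) : ℂ) • smoothingChannel f (coherentState y) := by
        simp only [smoothingChannel, h1, Finset.smul_sum, ← integral_smul]
        rw [← integral_finsetSum]
        · refine integral_congr_ae (Filter.Eventually.of_forall fun β => ?_)
          simp only [smul_comm ((f β : ℝ) : ℂ)]
        · intro y _
          exact (integrable_smul_displace hf (continuous_displace_coherentState y)).smul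
            ((c y : ℝ) : ℂ)
      rw [h2, ← Finset.sum_sub_distrib, map_sum]
      refine Finset.sum_eq_zero fun y _ => ?_
      rw [← smul_sub, map_smul, hF, smul_zero]
  obtain ⟨hS, hFS⟩ := key s
  set S := ∑ y ∈ s, ((c y : ℝ) : ℂ) • coherentState y
  have hP' := continuous_displace_mix hP
  have hPS : Continuous fun β => displace β (mix P - S) := by
    simp only [displace_sub]
    exact hP'.sub hS
  refine ⟨(mix P - S) - smoothingChannel f (mix P - S),
    (hT.sub (hT.smoothingChannel hf hPS)).mono (le_of_eq ?_), ?_⟩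
  · field_simp
  · rw [smoothingChannel_sub hf hP' hS, show mix P - S - (smoothingChannel f (mix P) -
      smoothingChannel f S) = (mix P - smoothingChannel f (mix P)) - (S - smoothingChannel f S) by
      abel, map_sub F _ (S - _), hFS, sub_zero]

/-! ### Density operators with a negative P-function -/

lemma lintegral_phaseMeasure_restrict (A : Set ℂ) (g : ℂ → ℝ≥0∞) :
    ∫⁻ α in A, g α ∂phaseMeasure = ENNReal.ofReal Real.pi⁻¹ * ∫⁻ α in A, g α := by
  rw [phaseMeasure, Measure.restrict_smul, lintegral_smul_measure, smul_eq_mul]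

lemma phaseMeasure_ball {r : ℝ} (hr : 0 ≤ r) (c : ℂ) :
    phaseMeasure (Metric.ball c r) = ENNReal.ofReal (r ^ 2) := by
  rw [phaseMeasure, Measure.smul_apply, Complex.volume_ball, smul_eq_mul,
    show ((NNReal.pi : ℝ≥0) : ℝ≥0∞) = ENNReal.ofReal Real.pi from ENNReal.ofReal_coe_nnreal.symm,
    mul_left_comm, ← ENNReal.ofReal_mul (by positivity), inv_mul_cancel₀ Real.pi_ne_zero,
    ENNReal.ofReal_one, mul_one, ENNReal.ofReal_pow hr]

lemma continuous_inner_coherentVec (ψ : Mode) :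
    Continuous fun α => (inner ℂ ψ (coherentVec α) : ℂ) :=
  (innerSL ℂ ψ).continuous.comp continuous_coherentVec

lemma integrableOn_norm_sq_inner_coherentVec (ψ : Mode) {A : Set ℂ} (hA : phaseMeasure A < ∞) :
    IntegrableOn (fun α => ‖(inner ℂ ψ (coherentVec α) : ℂ)‖ ^ 2) A phaseMeasure := by
  have : IsFiniteMeasure (phaseMeasure.restrict A) := ⟨by rwa [Measure.restrict_apply_univ]⟩
  refine Integrable.of_bound (C := ‖ψ‖ ^ 2)
    ((continuous_inner_coherentVec ψ).norm.pow 2).aestronglyMeasurable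
    (Filter.Eventually.of_forall fun α => ?_)
  rw [norm_pow, norm_norm]
  have := norm_inner_le_norm (𝕜 := ℂ) ψ (coherentVec α)
  rw [norm_coherentVec, mul_one] at this
  gcongr

lemma ofReal_setIntegral_norm_sq_inner (ψ : Mode) {A : Set ℂ} (hA : phaseMeasure A < ∞) :
    ENNReal.ofReal (∫ α in A, ‖(inner ℂ ψ (coherentVec α) : ℂ)‖ ^ 2 ∂phaseMeasure) =
      ∫⁻ α in A, ‖(inner ℂ ψ (coherentVec α) : ℂ)‖ₑ ^ 2 ∂phaseMeasure := by
  rw [ofReal_integral_eq_lintegral_ofReal (integrableOn_norm_sq_inner_coherentVec ψ hA)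
    (Filter.Eventually.of_forall fun α => by positivity)]
  simp only [← ofReal_norm, ENNReal.ofReal_pow (norm_nonneg _)]

instance : TopologicalSpace.SeparableSpace Mode := by
  have : Fact ((2 : ℝ≥0∞) ≠ ∞) := ⟨by simp⟩
  infer_instance

/-- Orthonormal vectors are `√2` apart, so balls of radius `1 / 2` around them are disjoint.
Countability permits the exchange of trace and integral. -/
lemma countable_of_orthonormal {E : Type*} [NormedAddCommGroup E] [InnerProductSpace ℂ E]
    [TopologicalSpace.SeparableSpace E] {w : Set E} (hw : Orthonormal ℂ ((↑) : w → E)) :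
    w.Countable := by
  refine Set.PairwiseDisjoint.countable_of_isOpen (s := fun x => Metric.ball x (1 / 2))
    (fun x hx y hy hxy => ?_) (fun _ _ => Metric.isOpen_ball)
    (fun x _ => ⟨x, Metric.mem_ball_self (by norm_num)⟩)
  refine Metric.ball_disjoint_ball ?_
  have h0 : (inner ℂ x y : ℂ) = 0 := hw.2 (i := ⟨x, hx⟩) (j := ⟨y, hy⟩) (by simpa using hxy)
  have h1 : ‖x‖ = 1 := hw.1 ⟨x, hx⟩
  have h2 : ‖y‖ = 1 := hw.1 ⟨y, hy⟩
  have h3 := norm_sub_sq (𝕜 := ℂ) x y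
  rw [h0, h1, h2] at h3
  rw [dist_eq_norm]
  simp only [map_zero] at h3
  nlinarith [norm_nonneg (x - y)]

lemma tsum_enorm_sq_inner {E ι : Type*} [NormedAddCommGroup E] [InnerProductSpace ℂ E]
    (b : HilbertBasis ι ℂ E) (x : E) : ∑' i, ‖(inner ℂ (b i) x : ℂ)‖ₑ ^ 2 = ‖x‖ₑ ^ 2 := by
  have h1 : HasSum (fun i => ‖(inner ℂ (b i) x : ℂ)‖ ^ 2) (‖x‖ ^ 2) := by
    have := (b.hasSum_inner_mul_inner x x).mapL Complex.reCLM
    convert this using 1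
    · ext i
      simp only [Complex.reCLM_apply, ← inner_conj_symm x (b i)]
      rw [← Complex.normSq_eq_conj_mul_self, Complex.ofReal_re, Complex.sq_norm]
    · exact (inner_self_eq_norm_sq (𝕜 := ℂ) x).symm
  rw [← ofReal_norm, ← ENNReal.ofReal_pow (norm_nonneg _), ← h1.tsum_eq,
    ENNReal.ofReal_tsum_of_nonneg (fun _ => by positivity) h1.summable]
  simp only [← ofReal_norm, ENNReal.ofReal_pow (norm_nonneg _)]

lemma tsum_setIntegral_norm_sq_inner {A : Set ℂ} (hA : phaseMeasure A < ∞) :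
    ∑' i : (exists_hilbertBasis ℂ Mode).choose, ENNReal.ofReal
      (∫ α in A, ‖(inner ℂ (i : Mode) (coherentVec α) : ℂ)‖ ^ 2 ∂phaseMeasure) =
      phaseMeasure A := by
  have : Countable (exists_hilbertBasis ℂ Mode).choose :=
    (countable_of_orthonormal (orthonormal_chosen Mode)).to_subtype
  obtain ⟨b, hb⟩ := (exists_hilbertBasis ℂ Mode).choose_spec
  simp only [ofReal_setIntegral_norm_sq_inner _ hA]
  have hsum := lintegral_tsum (μ := phaseMeasure.restrict A)
    (f := fun (i : (exists_hilbertBasis ℂ Mode).choose) α =>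
      ‖(inner ℂ (i : Mode) (coherentVec α) : ℂ)‖ₑ ^ 2) fun i =>
    ((continuous_inner_coherentVec (i : Mode)).measurable.enorm.pow_const 2).aemeasurable
  rw [← hsum]
  have h1 : ∀ α, ∑' i : (exists_hilbertBasis ℂ Mode).choose,
      ‖(inner ℂ (i : Mode) (coherentVec α) : ℂ)‖ₑ ^ 2 = 1 := fun α => by
    have := tsum_enorm_sq_inner b (coherentVec α)
    rw [hb, ← ofReal_norm, norm_coherentVec, ENNReal.ofReal_one, one_pow] at this
    exact this
  simp only [h1, setLIntegral_const, one_mul]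

section Step

variable {A B : Set ℂ} {a b : ℝ}

/-- The P-function `a` on `A` and `-b` on `B`. -/
def stepFun (A B : Set ℂ) (a b : ℝ) (α : ℂ) : ℝ :=
  A.indicator (fun _ => a) α - B.indicator (fun _ => b) α

lemma integrable_indicator_const (hA : MeasurableSet A) (hAf : phaseMeasure A < ∞) (a : ℝ) :
    Integrable (A.indicator fun _ => a) phaseMeasure :=
  (integrable_indicator_iff hA).2 (integrableOn_const hAf.ne)

lemma mix_indicator (hA : MeasurableSet A) (a : ℝ) :
    mix (A.indicator fun _ => a) = ∫ α in A, ((a : ℝ) : ℂ) • coherentState α ∂phaseMeasure := by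
  rw [mix, ← integral_indicator hA]
  refine integral_congr_ae (Filter.Eventually.of_forall fun α => ?_)
  by_cases h : α ∈ A <;> simp [h]

lemma mix_stepFun (hA : MeasurableSet A) (hB : MeasurableSet B) (hAf : phaseMeasure A < ∞)
    (hBf : phaseMeasure B < ∞) : mix (stepFun A B a b) =
      ∫ α in A, ((a : ℝ) : ℂ) • coherentState α ∂phaseMeasure -
      ∫ α in B, ((b : ℝ) : ℂ) • coherentState α ∂phaseMeasure := by
  rw [← mix_indicator hA, ← mix_indicator hB]
  exact mix_sub (integrable_indicator_const hA hAf a) (integrable_indicator_const hB hBf b)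

lemma inner_setIntegral_coherentState (hAf : phaseMeasure A < ∞) (ψ : Mode) :
    (inner ℂ ψ ((∫ α in A, ((a : ℝ) : ℂ) • coherentState α ∂phaseMeasure) ψ) : ℂ) =
      ((a * ∫ α in A, ‖(inner ℂ ψ (coherentVec α) : ℂ)‖ ^ 2 ∂phaseMeasure : ℝ) : ℂ) := by
  have h1 : Integrable (fun α => ((a : ℝ) : ℂ) • coherentState α) (phaseMeasure.restrict A) :=
    integrable_smul_coherentState (integrableOn_const (C := ((a : ℝ) : ℂ)) hAf.ne) continuous_id
  rw [inner_integral_apply h1, ← integral_const_mul, ← integral_complex_ofReal]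
  refine integral_congr_ae (Filter.Eventually.of_forall fun α => ?_)
  simp only [smul_apply, inner_smul_right, inner_coherentState, Complex.ofReal_mul]

lemma isDensityOperator_mix_stepFun (hA : MeasurableSet A) (hB : MeasurableSet B)
    (hAf : phaseMeasure A < ∞) (hBf : phaseMeasure B < ∞) (ha : 0 ≤ a) (hb : 0 ≤ b)
    (hdom : ∀ ψ : Mode, b * ∫ α in B, ‖(inner ℂ ψ (coherentVec α) : ℂ)‖ ^ 2 ∂phaseMeasure ≤
      a * ∫ α in A, ‖(inner ℂ ψ (coherentVec α) : ℂ)‖ ^ 2 ∂phaseMeasure)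
    (hone : a * phaseMeasure.real A - b * phaseMeasure.real B = 1) :
    IsDensityOperator (mix (stepFun A B a b)) := by
  have hin : ∀ ψ : Mode, (inner ℂ ψ (mix (stepFun A B a b) ψ) : ℂ) =
      ((a * ∫ α in A, ‖(inner ℂ ψ (coherentVec α) : ℂ)‖ ^ 2 ∂phaseMeasure -
        b * ∫ α in B, ‖(inner ℂ ψ (coherentVec α) : ℂ)‖ ^ 2 ∂phaseMeasure : ℝ) : ℂ) := fun ψ => by
    rw [mix_stepFun hA hB hAf hBf, sub_apply, inner_sub_right,
      inner_setIntegral_coherentState hAf, inner_setIntegral_coherentState hBf,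
      Complex.ofReal_sub]
  constructor
  · rw [ContinuousLinearMap.isPositive_iff_complex]
    intro ψ
    rw [← inner_conj_symm, hin ψ, Complex.conj_ofReal]
    exact ⟨rfl, sub_nonneg.2 (hdom ψ)⟩
  -- The trace is computed with the negative part moved to the other side, which avoids truncated
  -- subtraction in `[0, ∞]`.
  · have h1 : posTrace (mix (stepFun A B a b)) + ENNReal.ofReal b * phaseMeasure B =
        ENNReal.ofReal a * phaseMeasure A := by
      rw [← tsum_setIntegral_norm_sq_inner hAf, ← tsum_setIntegral_norm_sq_inner hBf,
        ← ENNReal.tsum_mul_left, ← ENNReal.tsum_mul_left, posTrace, ← ENNReal.tsum_add]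
      refine tsum_congr fun i => ?_
      rw [hin, Complex.ofReal_re, ← ENNReal.ofReal_mul ha, ← ENNReal.ofReal_mul hb,
        ← ENNReal.ofReal_add (sub_nonneg.2 (hdom _))
          (mul_nonneg hb (integral_nonneg fun _ => by positivity)), sub_add_cancel]
    have h2 : ENNReal.ofReal a * phaseMeasure A = 1 + ENNReal.ofReal b * phaseMeasure B := by
      rw [← ENNReal.ofReal_toReal hAf.ne, ← ENNReal.ofReal_toReal hBf.ne, ← ENNReal.ofReal_mul ha,
        ← ENNReal.ofReal_mul hb, ← ENNReal.ofReal_one, ← ENNReal.ofReal_add zero_le_one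
          (mul_nonneg hb ENNReal.toReal_nonneg)]
      congr 1
      simp only [Measure.real] at hone
      linarith
    rw [h2] at h1
    exact (ENNReal.add_left_inj (ENNReal.mul_ne_top ENNReal.ofReal_ne_top hBf.ne)).1 h1

lemma hasNegativePFunction_mix_stepFun (hA : MeasurableSet A) (hB : MeasurableSet B)
    (hAf : phaseMeasure A < ∞) (hBf : phaseMeasure B < ∞) (ha : 0 < a) (hb : 0 < b)
    (hd : Disjoint A B) (hvol : 0 < volume B) :
    HasNegativePFunction (mix (stepFun A B a b)) :=
  ⟨A, B, fun _ => a, fun _ => b, hA, hB, hd, hvol, fun _ _ => ha, fun _ _ => hb,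
    integrableOn_const hAf.ne, integrableOn_const hBf.ne, mix_stepFun hA hB hAf hBf⟩

end Step

lemma setIntegral_disc_le_annulus (ψ : Mode) {R : ℝ} (hR : 4 ≤ R) :
    Real.exp (-16) * ∫ α in Metric.ball 0 1, ‖(inner ℂ ψ (coherentVec α) : ℂ)‖ ^ 2 ∂phaseMeasure ≤
      ∫ α in Metric.ball 0 R \ Metric.ball 0 1,
        ‖(inner ℂ ψ (coherentVec α) : ℂ)‖ ^ 2 ∂phaseMeasure := by
  have hBf : phaseMeasure (Metric.ball (0 : ℂ) 1) < ∞ := by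
    rw [phaseMeasure_ball zero_le_one]
    exact ENNReal.ofReal_lt_top
  have hAf : phaseMeasure (Metric.ball (0 : ℂ) R \ Metric.ball 0 1) < ∞ := by
    refine (measure_mono Set.sdiff_subset).trans_lt ?_
    rw [phaseMeasure_ball (by linarith)]
    exact ENNReal.ofReal_lt_top
  have h1 : ENNReal.ofReal (∫ α in Metric.ball 0 1,
        ‖(inner ℂ ψ (coherentVec α) : ℂ)‖ ^ 2 ∂phaseMeasure) ≤
      ENNReal.ofReal (Real.exp 16 * ∫ α in Metric.ball 0 R \ Metric.ball 0 1,
        ‖(inner ℂ ψ (coherentVec α) : ℂ)‖ ^ 2 ∂phaseMeasure) := by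
    rw [ENNReal.ofReal_mul (Real.exp_pos _).le, ofReal_setIntegral_norm_sq_inner ψ hBf,
      ofReal_setIntegral_norm_sq_inner ψ hAf, lintegral_phaseMeasure_restrict,
      lintegral_phaseMeasure_restrict, mul_left_comm]
    gcongr
    refine (lintegral_disc_le_annulus ψ).trans ?_
    gcongr
  rw [ENNReal.ofReal_le_ofReal_iff (mul_nonneg (Real.exp_pos _).le
    (integral_nonneg fun _ => by positivity))] at h1
  rw [Real.exp_neg, inv_mul_le_iff₀ (Real.exp_pos _)]
  exact h1

/-! ### Almost invariant states -/

/-- Since `∫ f = 1`, the difference `P - P * f` is the `f`-average of `P - P (· - β)`; Fubini then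
reduces everything to translation estimates. -/
lemma integral_abs_sub_smooth_le {f P k : ℂ → ℝ} (hf : Integrable f phaseMeasure)
    (hone : ∫ β, f β ∂phaseMeasure = 1) (hP : Integrable P phaseMeasure)
    (hk : Integrable k phaseMeasure)
    (h : ∀ β, |f β| * ∫ γ, |P γ - P (γ - β)| ∂phaseMeasure ≤ k β) :
    ∫ γ, |P γ - smooth f P γ| ∂phaseMeasure ≤ ∫ β, k β ∂phaseMeasure := by
  have hi : Integrable (fun z : ℂ × ℂ => f z.2 * (P z.1 - P (z.1 - z.2)))
      (phaseMeasure.prod phaseMeasure) := by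
    simp only [mul_sub]
    refine Integrable.sub ?_ (integrable_smooth_integrand hf hP)
    simpa only [mul_comm] using hP.mul_prod hf
  have hi1 : Integrable (fun γ => ∫ β, |f β * (P γ - P (γ - β))| ∂phaseMeasure) phaseMeasure :=
    hi.abs.integral_prod_left
  have hi2 : Integrable (fun β => ∫ γ, |f β * (P γ - P (γ - β))| ∂phaseMeasure) phaseMeasure :=
    hi.abs.integral_prod_right
  have h1 : ∀ᵐ γ ∂phaseMeasure, |P γ - smooth f P γ| ≤
      ∫ β, |f β * (P γ - P (γ - β))| ∂phaseMeasure := by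
    filter_upwards [(integrable_smooth_integrand hf hP).prod_right_ae] with γ hγ
    have : P γ - smooth f P γ = ∫ β, f β * (P γ - P (γ - β)) ∂phaseMeasure := by
      simp only [mul_sub]
      rw [integral_sub (hf.mul_const _) hγ, integral_mul_const, hone, one_mul, smooth]
    rw [this]
    exact abs_integral_le_integral_abs
  calc _ ≤ ∫ γ, (∫ β, |f β * (P γ - P (γ - β))| ∂phaseMeasure) ∂phaseMeasure :=
        integral_mono_ae (hP.sub (integrable_smooth hf hP)).abs hi1 h1
    _ = ∫ β, (∫ γ, |f β * (P γ - P (γ - β))| ∂phaseMeasure) ∂phaseMeasure :=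
        integral_integral_swap hi.abs
    _ ≤ ∫ β, k β ∂phaseMeasure := by
        refine integral_mono hi2 hk fun β => ?_
        simp only [abs_mul, integral_const_mul]
        exact h β

/-- A point in exactly one of the disc and its translate lies in the annulus `R ≤ |γ| < R + |β|` or
in the translate of that annulus by `β`. -/
lemma integral_abs_indicator_ball_sub_translate_le {R : ℝ} (hR : 0 ≤ R) (β : ℂ) :
    ∫ γ, |(Metric.ball (0 : ℂ) R).indicator (fun _ => (1 : ℝ)) γ -
      (Metric.ball (0 : ℂ) R).indicator (fun _ => (1 : ℝ)) (γ - β)| ∂phaseMeasure ≤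
      2 * ((R + ‖β‖) ^ 2 - R ^ 2) := by
  have hb : ∀ {r : ℝ}, 0 ≤ r → Integrable ((Metric.ball (0 : ℂ) r).indicator fun _ => (1 : ℝ))
      phaseMeasure := fun {r} hr =>
    integrable_indicator_const measurableSet_ball
      (by rw [phaseMeasure_ball hr]; exact ENNReal.ofReal_lt_top) 1
  have hv : ∀ {r : ℝ}, 0 ≤ r → ∫ γ, (Metric.ball (0 : ℂ) r).indicator (fun _ => (1 : ℝ)) γ
      ∂phaseMeasure = r ^ 2 := fun {r} hr => by
    rw [integral_indicator measurableSet_ball, setIntegral_const, smul_eq_mul, mul_one,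
      Measure.real, phaseMeasure_ball hr, ENNReal.toReal_ofReal (by positivity)]
  have hR' : 0 ≤ R + ‖β‖ := by positivity
  set u : ℂ → ℝ := fun γ => (Metric.ball (0 : ℂ) (R + ‖β‖)).indicator (fun _ => (1 : ℝ)) γ -
    (Metric.ball (0 : ℂ) R).indicator (fun _ => (1 : ℝ)) γ with hu
  have hui : Integrable u phaseMeasure := (hb hR').sub (hb hR)
  have huv : ∫ γ, u γ ∂phaseMeasure = (R + ‖β‖) ^ 2 - R ^ 2 := by
    rw [hu, integral_sub (hb hR') (hb hR), hv hR', hv hR]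
  calc _ ≤ ∫ γ, (u γ + u (γ - β)) ∂phaseMeasure := by
        refine integral_mono ((hb hR).sub ((hb hR).comp_sub_right β)).abs
          (hui.add (hui.comp_sub_right β)) fun γ => ?_
        have h1 := norm_sub_le γ β
        have h2 := norm_le_norm_sub_add γ β
        have h3 := norm_nonneg β
        simp only [hu, Set.indicator, mem_ball_zero_iff]
        split_ifs <;> first | (exfalso; linarith) | norm_num
    _ = _ := by
        rw [integral_add hui (hui.comp_sub_right β), integral_sub_right_eq_self, huv]
        ring

/-- A flat P-function of radius `R` with a shallow negative disc of radius one. -/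
def dimpledDisc (c R : ℝ) : ℂ → ℝ :=
  stepFun (Metric.ball 0 R \ Metric.ball 0 1) (Metric.ball 0 1) c (c * Real.exp (-16))

lemma dimpledDisc_eq (c : ℝ) {R : ℝ} (hR : 1 ≤ R) (α : ℂ) : dimpledDisc c R α =
    c * ((Metric.ball (0 : ℂ) R).indicator (fun _ => (1 : ℝ)) α -
      (1 + Real.exp (-16)) * (Metric.ball (0 : ℂ) 1).indicator (fun _ => (1 : ℝ)) α) := by
  simp only [dimpledDisc, stepFun, Set.indicator, Set.mem_sdiff, mem_ball_zero_iff]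
  split_ifs <;> first | (exfalso; linarith) | (exfalso; tauto) | ring

lemma phaseMeasure_ball_lt_top {r : ℝ} (hr : 0 ≤ r) (c : ℂ) :
    phaseMeasure (Metric.ball c r) < ∞ := by
  rw [phaseMeasure_ball hr]
  exact ENNReal.ofReal_lt_top

lemma phaseMeasure_real_ball {r : ℝ} (hr : 0 ≤ r) (c : ℂ) :
    phaseMeasure.real (Metric.ball c r) = r ^ 2 := by
  rw [Measure.real, phaseMeasure_ball hr, ENNReal.toReal_ofReal (by positivity)]

lemma phaseMeasure_annulus_lt_top {R : ℝ} (hR : 0 ≤ R) :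
    phaseMeasure (Metric.ball (0 : ℂ) R \ Metric.ball 0 1) < ∞ :=
  (measure_mono Set.sdiff_subset).trans_lt (phaseMeasure_ball_lt_top hR 0)

lemma integrable_dimpledDisc (c : ℝ) {R : ℝ} (hR : 0 ≤ R) :
    Integrable (dimpledDisc c R) phaseMeasure :=
  (integrable_indicator_const (measurableSet_ball.diff measurableSet_ball)
    (phaseMeasure_annulus_lt_top hR) c).sub
    (integrable_indicator_const measurableSet_ball (phaseMeasure_ball_lt_top zero_le_one 0) _)

/-- In units of `d²α / π` the annulus has area `R² - 1` and the dimple area one, whence the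
normalisation of `c`. The condition `4 ≤ R` makes room for the annulus that dominates the dimple. -/
lemma isDensityOperator_mix_dimpledDisc {c R : ℝ} (hR : 4 ≤ R)
    (hc : c * (R ^ 2 - 1 - Real.exp (-16)) = 1) (hc0 : 0 < c) :
    IsDensityOperator (mix (dimpledDisc c R)) := by
  refine isDensityOperator_mix_stepFun (measurableSet_ball.diff measurableSet_ball)
    measurableSet_ball (phaseMeasure_annulus_lt_top (by linarith))
    (phaseMeasure_ball_lt_top zero_le_one 0) hc0.le (by positivity) (fun ψ => ?_) ?_
  · rw [mul_assoc]
    exact mul_le_mul_of_nonneg_left (setIntegral_disc_le_annulus ψ hR) hc0.le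
  · rw [measureReal_sdiff (s₁ := Metric.ball (0 : ℂ) R) (Metric.ball_subset_ball (by linarith))
      measurableSet_ball (phaseMeasure_ball_lt_top (by linarith) 0).ne, phaseMeasure_real_ball (by linarith),
      phaseMeasure_real_ball zero_le_one]
    linarith

lemma hasNegativePFunction_mix_dimpledDisc {c R : ℝ} (hR : 0 ≤ R) (hc0 : 0 < c) :
    HasNegativePFunction (mix (dimpledDisc c R)) :=
  hasNegativePFunction_mix_stepFun (measurableSet_ball.diff measurableSet_ball)
    measurableSet_ball (phaseMeasure_annulus_lt_top hR) (phaseMeasure_ball_lt_top zero_le_one 0)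
    hc0 (by positivity) Set.disjoint_sdiff_left (Metric.measure_ball_pos _ _ one_pos)

lemma integral_abs_dimpledDisc_sub_translate_le {c R : ℝ} (hR : 1 ≤ R) (hc0 : 0 ≤ c) (β : ℂ) :
    ∫ γ, |dimpledDisc c R γ - dimpledDisc c R (γ - β)| ∂phaseMeasure ≤
      c * (4 * R * ‖β‖ + 6 * ‖β‖ ^ 2 + 8 * ‖β‖) := by
  have hb : ∀ {r : ℝ}, 0 ≤ r → Integrable ((Metric.ball (0 : ℂ) r).indicator fun _ => (1 : ℝ))
      phaseMeasure := fun {r} hr =>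
    integrable_indicator_const measurableSet_ball (phaseMeasure_ball_lt_top hr 0) 1
  have hd : ∀ {r : ℝ}, 0 ≤ r → Integrable (fun γ =>
      |(Metric.ball (0 : ℂ) r).indicator (fun _ => (1 : ℝ)) γ -
        (Metric.ball (0 : ℂ) r).indicator (fun _ => (1 : ℝ)) (γ - β)|) phaseMeasure :=
    fun {r} hr => ((hb hr).sub ((hb hr).comp_sub_right β)).abs
  have hR0 : 0 ≤ R := by linarith
  have hi := integrable_dimpledDisc c hR0
  have he : Real.exp (-16) ≤ 1 := Real.exp_le_one_iff.2 (by norm_num)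
  calc _ ≤ ∫ γ, c * (|(Metric.ball (0 : ℂ) R).indicator (fun _ => (1 : ℝ)) γ -
        (Metric.ball (0 : ℂ) R).indicator (fun _ => (1 : ℝ)) (γ - β)| +
        2 * |(Metric.ball (0 : ℂ) 1).indicator (fun _ => (1 : ℝ)) γ -
        (Metric.ball (0 : ℂ) 1).indicator (fun _ => (1 : ℝ)) (γ - β)|) ∂phaseMeasure := by
        refine integral_mono (hi.sub (hi.comp_sub_right β)).abs
          (((hd hR0).add ((hd zero_le_one).const_mul 2)).const_mul c) fun γ => ?_
        simp only [dimpledDisc_eq c hR]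
        generalize (Metric.ball (0 : ℂ) R).indicator (fun _ => (1 : ℝ)) γ = x
        generalize (Metric.ball (0 : ℂ) R).indicator (fun _ => (1 : ℝ)) (γ - β) = x'
        generalize (Metric.ball (0 : ℂ) 1).indicator (fun _ => (1 : ℝ)) γ = y
        generalize (Metric.ball (0 : ℂ) 1).indicator (fun _ => (1 : ℝ)) (γ - β) = y'
        rw [← mul_sub, abs_mul, abs_of_nonneg hc0]
        refine mul_le_mul_of_nonneg_left ?_ hc0
        rw [show x - (1 + Real.exp (-16)) * y - (x' - (1 + Real.exp (-16)) * y') =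
          (x - x') - (1 + Real.exp (-16)) * (y - y') by ring]
        refine (abs_sub _ _).trans ?_
        rw [abs_mul, abs_of_pos (by positivity : 0 < 1 + Real.exp (-16))]
        gcongr
        linarith
    _ = c * ((∫ γ, |(Metric.ball (0 : ℂ) R).indicator (fun _ => (1 : ℝ)) γ -
        (Metric.ball (0 : ℂ) R).indicator (fun _ => (1 : ℝ)) (γ - β)| ∂phaseMeasure) +
        2 * ∫ γ, |(Metric.ball (0 : ℂ) 1).indicator (fun _ => (1 : ℝ)) γ -
        (Metric.ball (0 : ℂ) 1).indicator (fun _ => (1 : ℝ)) (γ - β)| ∂phaseMeasure) := by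
        rw [integral_const_mul, integral_add (hd hR0) ((hd zero_le_one).const_mul 2),
          integral_const_mul]
    _ ≤ c * (2 * ((R + ‖β‖) ^ 2 - R ^ 2) + 2 * (2 * ((1 + ‖β‖) ^ 2 - 1 ^ 2))) := by
        gcongr
        · exact integral_abs_indicator_ball_sub_translate_le hR0 β
        · exact integral_abs_indicator_ball_sub_translate_le zero_le_one β
    _ = _ := by ring

/-- A bound uniform in `β`, from `2 ‖P‖₁`. It supplies the dominating function, because `f` need not
have finite moments against which the bound quadratic in `|β|` could be integrated. -/
lemma integral_abs_dimpledDisc_sub_translate_le' {c R : ℝ} (hR : 1 ≤ R) (hc0 : 0 ≤ c) (β : ℂ) :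
    ∫ γ, |dimpledDisc c R γ - dimpledDisc c R (γ - β)| ∂phaseMeasure ≤
      2 * (c * (R ^ 2 + 2)) := by
  have hb : ∀ {r : ℝ}, 0 ≤ r → Integrable ((Metric.ball (0 : ℂ) r).indicator fun _ => (1 : ℝ))
      phaseMeasure := fun {r} hr =>
    integrable_indicator_const measurableSet_ball (phaseMeasure_ball_lt_top hr 0) 1
  have hv : ∀ {r : ℝ}, 0 ≤ r → ∫ γ, (Metric.ball (0 : ℂ) r).indicator (fun _ => (1 : ℝ)) γ
      ∂phaseMeasure = r ^ 2 := fun {r} hr => by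
    rw [integral_indicator measurableSet_ball, setIntegral_const, smul_eq_mul, mul_one,
      phaseMeasure_real_ball hr]
  have hR0 : 0 ≤ R := by linarith
  have hi := integrable_dimpledDisc c hR0
  have he : Real.exp (-16) ≤ 1 := Real.exp_le_one_iff.2 (by norm_num)
  have h1 : ∫ γ, |dimpledDisc c R γ| ∂phaseMeasure ≤ c * (R ^ 2 + 2) := by
    calc _ ≤ ∫ γ, c * ((Metric.ball (0 : ℂ) R).indicator (fun _ => (1 : ℝ)) γ +
          2 * (Metric.ball (0 : ℂ) 1).indicator (fun _ => (1 : ℝ)) γ) ∂phaseMeasure := by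
          refine integral_mono hi.abs (((hb hR0).add ((hb zero_le_one).const_mul 2)).const_mul c)
            fun γ => ?_
          have hx : 0 ≤ (Metric.ball (0 : ℂ) R).indicator (fun _ => (1 : ℝ)) γ :=
            Set.indicator_nonneg (fun _ _ => zero_le_one) _
          have hy : 0 ≤ (Metric.ball (0 : ℂ) 1).indicator (fun _ => (1 : ℝ)) γ :=
            Set.indicator_nonneg (fun _ _ => zero_le_one) _
          simp only [dimpledDisc_eq c hR]
          rw [abs_mul, abs_of_nonneg hc0]
          refine mul_le_mul_of_nonneg_left ((abs_sub _ _).trans ?_) hc0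
          rw [abs_mul, abs_of_pos (by positivity : 0 < 1 + Real.exp (-16)), abs_of_nonneg hx,
            abs_of_nonneg hy]
          gcongr
          linarith
      _ = _ := by
          rw [integral_const_mul, integral_add (hb hR0) ((hb zero_le_one).const_mul 2),
            integral_const_mul, hv hR0, hv zero_le_one]
          ring
  calc _ ≤ ∫ γ, (|dimpledDisc c R γ| + |dimpledDisc c R (γ - β)|) ∂phaseMeasure :=
        integral_mono (hi.sub (hi.comp_sub_right β)).abs (hi.abs.add (hi.abs.comp_sub_right β))
          fun γ => abs_sub _ _
    _ = 2 * ∫ γ, |dimpledDisc c R γ| ∂phaseMeasure := by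
        rw [integral_add hi.abs (hi.abs.comp_sub_right β),
          integral_sub_right_eq_self (fun γ => |dimpledDisc c R γ|)]
        ring
    _ ≤ _ := by gcongr

lemma exists_almost_invariant_state {f : ℂ → ℝ} (hf : Integrable f phaseMeasure)
    (hone : ∫ β, f β ∂phaseMeasure = 1) {η : ℝ} (hη : 0 < η) :
    ∃ P : ℂ → ℝ, Integrable P phaseMeasure ∧ IsDensityOperator (mix P) ∧
      HasNegativePFunction (mix P) ∧ ∫ γ, |P γ - smooth f P γ| ∂phaseMeasure ≤ η := by
  -- `B n` combines both translation estimates at `R = n + 4`, using `c ≤ 2 / R²`. The uniform one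
  -- gives `4 + 8 / R² ≤ 5`, and the other vanishes as `R → ∞` for fixed `β`.
  let B : ℕ → ℂ → ℝ := fun n β => min 5
    (2 * (4 * ‖β‖ * (1 / ((n : ℝ) + 4)) + (6 * ‖β‖ ^ 2 + 8 * ‖β‖) * (1 / ((n : ℝ) + 4)) ^ 2))
  have hB0 : ∀ n β, 0 ≤ B n β := fun n β => le_min (by norm_num) (by positivity)
  have hB5 : ∀ n β, B n β ≤ 5 := fun n β => min_le_left _ _
  have hm : ∀ n, AEStronglyMeasurable (fun β => |f β| * B n β) phaseMeasure := fun n =>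
    hf.abs.1.mul (Continuous.aestronglyMeasurable (by fun_prop))
  have hb : ∀ n β, ‖|f β| * B n β‖ ≤ 5 * |f β| := fun n β => by
    rw [Real.norm_eq_abs, abs_of_nonneg (mul_nonneg (abs_nonneg _) (hB0 n β)), mul_comm]
    exact mul_le_mul_of_nonneg_right (hB5 n β) (abs_nonneg _)
  have hlim : Filter.Tendsto (fun n => ∫ β, |f β| * B n β ∂phaseMeasure) Filter.atTop (nhds 0) := by
    rw [← integral_zero ℂ ℝ (μ := phaseMeasure)]
    refine tendsto_integral_of_dominated_convergence (fun β => 5 * |f β|) hm (hf.abs.const_mul 5)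
      (fun n => Filter.Eventually.of_forall (hb n)) (Filter.Eventually.of_forall fun β => ?_)
    have h1 : Filter.Tendsto (fun n : ℕ => 1 / ((n : ℝ) + 4)) Filter.atTop (nhds 0) := by
      have := (tendsto_const_div_atTop_nhds_zero_nat (1 : ℝ)).comp (Filter.tendsto_add_atTop_nat 4)
      simpa [Function.comp_def] using this
    have h2 : Continuous fun t : ℝ => |f β| * min 5
        (2 * (4 * ‖β‖ * t + (6 * ‖β‖ ^ 2 + 8 * ‖β‖) * t ^ 2)) := by fun_prop
    have h3 := (h2.tendsto 0).comp h1
    simpa [Function.comp_def, B] using h3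
  obtain ⟨n, hn⟩ := (hlim.eventually_le_const hη).exists
  have hR : (4 : ℝ) ≤ (n : ℝ) + 4 := by linarith [Nat.cast_nonneg (α := ℝ) n]
  set R : ℝ := (n : ℝ) + 4 with hRdef
  have he : Real.exp (-16) ≤ 1 := Real.exp_le_one_iff.2 (by norm_num)
  have hD : R ^ 2 / 2 ≤ R ^ 2 - 1 - Real.exp (-16) := by nlinarith
  have hD0 : 0 < R ^ 2 - 1 - Real.exp (-16) := by nlinarith
  set c : ℝ := (R ^ 2 - 1 - Real.exp (-16))⁻¹ with hc
  have hc0 : 0 < c := inv_pos.2 hD0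
  have hc2 : c ≤ 2 * (1 / R) ^ 2 := by
    rw [hc, show 2 * (1 / R) ^ 2 = (R ^ 2 / 2)⁻¹ by field_simp]
    exact inv_anti₀ (by positivity) hD
  have hi := integrable_dimpledDisc c (by linarith : 0 ≤ R)
  refine ⟨dimpledDisc c R, hi, isDensityOperator_mix_dimpledDisc hR (inv_mul_cancel₀ hD0.ne') hc0,
    hasNegativePFunction_mix_dimpledDisc (by linarith) hc0, ?_⟩
  refine (integral_abs_sub_smooth_le hf hone hi
    ((hf.abs.const_mul 5).mono' (hm n) (Filter.Eventually.of_forall (hb n))) fun β => ?_).trans hn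
  refine mul_le_mul_of_nonneg_left (le_min ?_ ?_) (abs_nonneg _)
  · refine (integral_abs_dimpledDisc_sub_translate_le' (by linarith) hc0.le β).trans ?_
    calc 2 * (c * (R ^ 2 + 2)) ≤ 2 * (2 * (1 / R) ^ 2 * (R ^ 2 + 2)) := by gcongr
      _ = 4 + 8 / R ^ 2 := by field_simp; ring
      _ ≤ 5 := by
        have : 8 / R ^ 2 ≤ 1 := by rw [div_le_one (by positivity)]; nlinarith
        linarith
  · refine (integral_abs_dimpledDisc_sub_translate_le (by linarith) hc0.le β).trans ?_
    calc _ ≤ 2 * (1 / R) ^ 2 * (4 * R * ‖β‖ + 6 * ‖β‖ ^ 2 + 8 * ‖β‖) := by gcongr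
      _ = _ := by rw [← hRdef]; field_simp; ring

/-! ### Bounds for linear functionals -/

/-- Lower semicontinuity across exponents: convergence in `L^q` implies convergence in measure,
along which a bound on the `L^r` norm persists. -/
lemma eLpNorm_le_of_tendsto_Lp {Ω : Type*} [MeasurableSpace Ω] {μ : Measure Ω} {q r : ℝ≥0∞}
    [Fact (1 ≤ q)] {g : ℕ → Lp ℂ q μ} {g₀ : Lp ℂ q μ}
    (h : Filter.Tendsto g Filter.atTop (nhds g₀)) {C : ℝ≥0∞} (hC : ∀ n, eLpNorm (g n) r μ ≤ C) :
    eLpNorm g₀ r μ ≤ C :=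
  eLpNorm_le_of_tendstoInMeasure (Filter.Eventually.of_forall hC)
    (tendstoInMeasure_of_tendsto_Lp h) fun _ => Lp.aestronglyMeasurable _

section FunctionFunctional

variable {Ω : Type*} [MeasurableSpace Ω] {μ : Measure Ω} {q r : ℝ≥0∞}

lemma norm_le_of_traceBound {F : Op →ₗ[ℂ] Lp ℂ q μ} {c : ℝ≥0}
    (hF : ∀ X : Op, schattenNorm 1 X < ∞ → eLpNorm (F X) q μ ≤ c * schattenNorm 1 X)
    {T : Op} {ε : ℝ} (hT : TraceBound T ε) : ‖F T‖ ≤ c * ε := by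
  rw [Lp.norm_def]
  refine ENNReal.toReal_le_of_le_ofReal (mul_nonneg c.coe_nonneg hT.nonneg) ?_
  rw [ENNReal.ofReal_mul c.coe_nonneg, ENNReal.ofReal_coe_nnreal]
  exact (hF T hT.schattenNorm_lt_top).trans (mul_le_mul_right hT.schattenNorm_le _)

/-- `F` is bounded only into `L^q`, so the `L^r` bound is obtained for finite combinations by the
triangle inequality and passed to the limit taken in `L^q`. -/
lemma eLpNorm_map_mix_le [Fact (1 ≤ q)] {F : Op →ₗ[ℂ] Lp ℂ q μ} {c : ℝ≥0}
    (hF : ∀ X : Op, schattenNorm 1 X < ∞ → eLpNorm (F X) q μ ≤ c * schattenNorm 1 X)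
    (hr : 1 ≤ r) {M : ℝ≥0∞} (hM : ∀ α, eLpNorm (F (coherentState α)) r μ ≤ M)
    {P : ℂ → ℝ} (hP : Integrable P phaseMeasure) :
    eLpNorm (F (mix P)) r μ ≤ ENNReal.ofReal (∫ α, |P α| ∂phaseMeasure) * M := by
  have hpos : ∀ n : ℕ, (0 : ℝ) < 1 / ((n : ℝ) + 1) := fun n => by positivity
  choose s a ha hT using fun n : ℕ => exists_finite_approx hP (hpos n)
  refine eLpNorm_le_of_tendsto_Lp
    (g := fun n => F (∑ y ∈ s n, ((a n y : ℝ) : ℂ) • coherentState y)) ?_ fun n => ?_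
  · rw [tendsto_iff_norm_sub_tendsto_zero]
    have h1 : Filter.Tendsto (fun n : ℕ => (c : ℝ) * (1 / ((n : ℝ) + 1))) Filter.atTop (nhds 0) := by
      simpa using tendsto_one_div_add_atTop_nhds_zero_nat.const_mul (c : ℝ)
    refine squeeze_zero (fun _ => norm_nonneg _) (fun n => ?_) h1
    rw [norm_sub_rev, ← map_sub]
    exact norm_le_of_traceBound hF (hT n)
  · have key : ∀ t : Finset ℂ, eLpNorm (F (∑ y ∈ t, ((a n y : ℝ) : ℂ) • coherentState y)) r μ ≤
        ∑ y ∈ t, ENNReal.ofReal |a n y| * M := fun t => by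
      induction t using Finset.induction_on with
      | empty =>
        rw [Finset.sum_empty, map_zero, eLpNorm_congr_ae (Lp.coeFn_zero ℂ q μ), eLpNorm_zero,
          Finset.sum_empty]
      | insert y t hy ih =>
        rw [Finset.sum_insert hy, Finset.sum_insert hy, map_add, map_smul,
          eLpNorm_congr_ae (Lp.coeFn_add _ _)]
        refine (eLpNorm_add_le (Lp.aestronglyMeasurable _) (Lp.aestronglyMeasurable _) hr).trans
          (add_le_add ?_ ih)
        rw [eLpNorm_congr_ae (Lp.coeFn_smul _ _), eLpNorm_const_smul]
        refine mul_le_mul' (le_of_eq ?_) (hM y)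
        rw [← ofReal_norm, Complex.norm_real, Real.norm_eq_abs]
    refine (key (s n)).trans ?_
    rw [← Finset.sum_mul, ← ENNReal.ofReal_sum_of_nonneg fun _ _ => abs_nonneg _]
    exact mul_le_mul' (ENNReal.ofReal_le_ofReal (ha n)) le_rfl

end FunctionFunctional

/-! ### The no-go theorem -/

/-- The part of the argument common to both kinds of functional; only `hle` and `hzero` depend on
the kind. -/
lemma exists_undetected_state {f : ℂ → ℝ} (hf : Integrable f phaseMeasure)
    (hone : ∫ β, f β ∂phaseMeasure = 1) (N : Op → ℝ≥0∞) (hN : N vacuumState < ∞) {C : ℝ≥0∞}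
    (hC : C < ∞) (hle : ∀ P, Integrable P phaseMeasure →
      N (mix P) ≤ ENNReal.ofReal (∫ α, |P α - smooth f P α| ∂phaseMeasure) * C)
    (hzero : N vacuumState = 0 → ∀ P, Integrable P phaseMeasure → N (mix P) = 0) :
    N vacuumState < ∞ ∧ ∃ ρ : Op, IsDensityOperator ρ ∧ HasNegativePFunction ρ ∧
      ¬ IsClassicalState ρ ∧ N ρ ≤ N vacuumState ∧ witness N ρ ≤ 0 ∧
      (N vacuumState ≠ 0 → witness N ρ < 0) := by
  refine ⟨hN, ?_⟩
  by_cases h0 : N vacuumState = 0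
  · obtain ⟨P, hP, hd, hneg, -⟩ := exists_almost_invariant_state hf hone one_pos
    have hz := hzero h0 P hP
    exact ⟨mix P, hd, hneg, hneg.not_isClassicalState, by rw [hz, h0],
      by rw [witness, hz, h0, sub_self], fun h => absurd h0 h⟩
  -- The `+ 1` keeps the quotient meaningful when `C = 0` and makes the final inequality strict.
  · have hη : 0 < (N vacuumState).toReal / (C.toReal + 1) :=
      div_pos (ENNReal.toReal_pos h0 hN.ne) (by positivity)
    obtain ⟨P, hP, hd, hneg, hsm⟩ := exists_almost_invariant_state hf hone hη
    have hlt : N (mix P) < N vacuumState := by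
      refine (hle P hP).trans_lt ?_
      rw [← ENNReal.ofReal_toReal hC.ne, ← ENNReal.ofReal_mul (integral_nonneg fun _ => abs_nonneg _),
        ENNReal.ofReal_lt_iff_lt_toReal (by positivity) hN.ne]
      calc _ ≤ (N vacuumState).toReal / (C.toReal + 1) * C.toReal := by gcongr
        _ < (N vacuumState).toReal / (C.toReal + 1) * (C.toReal + 1) := by gcongr; linarith
        _ = (N vacuumState).toReal := by field_simp
    have hw : witness N (mix P) < 0 :=
      sub_neg.2 (ENNReal.toReal_strict_mono hN.ne hlt)
    exact ⟨mix P, hd, hneg, hneg.not_isClassicalState, hlt.le, hw.le, fun _ => hw⟩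

lemma mix_sub_smoothingChannel {f P : ℂ → ℝ} (hf : Integrable f phaseMeasure)
    (hP : Integrable P phaseMeasure) :
    mix P - smoothingChannel f (mix P) = mix fun α => P α - smooth f P α := by
  rw [smoothingChannel_mix hf hP, mix_sub hP (integrable_smooth hf hP)]

lemma traceBound_vacuumState_sub {f : ℂ → ℝ} (hf : Integrable f phaseMeasure) :
    TraceBound (vacuumState - smoothingChannel f vacuumState) (1 + ∫ β, |f β| ∂phaseMeasure) := by
  rw [smoothingChannel_vacuumState]
  exact (traceBound_coherentState 0).sub (traceBound_mix hf)

/-- By linearity `F` is always applied to a single operator with a known trace bound, so no triangle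
inequality for `schattenNorm p` enters. -/
theorem operatorMeasure_exists_undetected_state {p : ℝ} (hp : 0 < p) {f : ℂ → ℝ}
    (hf : IsQuantumnessBreaking f) {K : Type*} [NormedAddCommGroup K] [InnerProductSpace ℂ K]
    [CompleteSpace K] (F : Op →ₗ[ℂ] (K →L[ℂ] K)) (hF : IsOperatorFunctional p F) :
    operatorMeasure p F f vacuumState < ∞ ∧ ∃ ρ : Op, IsDensityOperator ρ ∧
      HasNegativePFunction ρ ∧ ¬ IsClassicalState ρ ∧
      operatorMeasure p F f ρ ≤ operatorMeasure p F f vacuumState ∧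
      witness (operatorMeasure p F f) ρ ≤ 0 ∧
      (operatorMeasure p F f vacuumState ≠ 0 → witness (operatorMeasure p F f) ρ < 0) := by
  obtain ⟨c, hc⟩ := hF.bounded
  have hT : ∀ {T : Op} {ε : ℝ}, TraceBound T ε →
      schattenNorm p (F T) ≤ ENNReal.ofReal ε * c := fun {T ε} h => by
    rw [mul_comm]
    exact (hc T h.schattenNorm_lt_top).trans (mul_le_mul_right h.schattenNorm_le _)
  refine exists_undetected_state hf.integrable hf.normalised (operatorMeasure p F f) ?_
    (C := c) ENNReal.coe_lt_top (fun P hP => ?_) (fun h0 P hP => ?_)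
  · rw [operatorMeasure, ← map_sub]
    exact (hT (traceBound_vacuumState_sub hf.integrable)).trans_lt
      (ENNReal.mul_lt_top ENNReal.ofReal_lt_top ENNReal.coe_lt_top)
  · rw [operatorMeasure, ← map_sub, mix_sub_smoothingChannel hf.integrable hP]
    exact hT (traceBound_mix (hP.sub (integrable_smooth hf.integrable hP)))
  · rw [operatorMeasure, ← map_sub] at h0 ⊢
    have hv := eq_zero_of_schattenNorm_eq_zero hp h0
    have hcoh : ∀ α, F (coherentState α - smoothingChannel f (coherentState α)) = 0 := fun α => by
      obtain ⟨U, -, hU⟩ := hF.covariant α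
      rw [← displace_vacuumState_sub_smoothingChannel hf.integrable,
        hU _ (traceBound_vacuumState_sub hf.integrable).schattenNorm_lt_top, hv, mul_zero, zero_mul]
    have hlim : Filter.Tendsto (fun n : ℕ => ENNReal.ofReal (1 / ((n : ℝ) + 1)) * (c : ℝ≥0∞))
        Filter.atTop (nhds 0) := by
      have := ENNReal.Tendsto.mul_const (b := (c : ℝ≥0∞))
        (ENNReal.tendsto_ofReal tendsto_one_div_add_atTop_nhds_zero_nat) (Or.inr ENNReal.coe_ne_top)
      simpa using this
    refine le_antisymm (ge_of_tendsto' hlim fun n => ?_) zero_le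
    obtain ⟨T, hTn, hFT⟩ := exists_traceBound_of_vanishing hf.integrable F hcoh hP
      (by positivity : (0 : ℝ) < 1 / ((n : ℝ) + 1))
    rw [hFT]
    exact hT hTn

theorem functionMeasure_exists_undetected_state {p : ℝ} (hp : 1 ≤ p) {f : ℂ → ℝ}
    (hf : IsQuantumnessBreaking f) {Ω : Type*} [MeasurableSpace Ω] (μ : Measure Ω) (q : ℝ≥0∞)
    [Fact (1 ≤ q)] (F : Op →ₗ[ℂ] Lp ℂ q μ) (hF : IsFunctionFunctional μ p q F) :
    functionMeasure μ p q F f vacuumState < ∞ ∧ ∃ ρ : Op, IsDensityOperator ρ ∧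
      HasNegativePFunction ρ ∧ ¬ IsClassicalState ρ ∧
      functionMeasure μ p q F f ρ ≤ functionMeasure μ p q F f vacuumState ∧
      witness (functionMeasure μ p q F f) ρ ≤ 0 ∧
      (functionMeasure μ p q F f vacuumState ≠ 0 →
        witness (functionMeasure μ p q F f) ρ < 0) := by
  obtain ⟨c, hc⟩ := hF.bounded
  have hr : 1 ≤ ENNReal.ofReal p := ENNReal.one_le_ofReal.2 hp
  -- Covariance gives all coherent states the same `L^p` norm as the vacuum; this common value is
  -- the constant `C` below.
  have hM : ∀ α, eLpNorm (F (coherentState α)) (ENNReal.ofReal p) μ ≤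
      eLpNorm (F vacuumState) (ENNReal.ofReal p) μ := fun α => by
    obtain ⟨V, hVn, hV⟩ := hF.covariant α
    have h1 := hV vacuumState (traceBound_coherentState 0).schattenNorm_lt_top
    rw [vacuumState, displace_coherentState, add_zero] at h1
    rw [h1, hVn, vacuumState]
  refine exists_undetected_state hf.integrable hf.normalised (functionMeasure μ p q F f) ?_
    hF.finite_vacuum (fun P hP => ?_) (fun h0 P hP => ?_)
  · rw [functionMeasure, eLpNorm_congr_ae (Lp.coeFn_sub _ _), smoothingChannel_vacuumState]
    refine (eLpNorm_sub_le (Lp.aestronglyMeasurable _) (Lp.aestronglyMeasurable _) hr).trans_lt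
      (ENNReal.add_lt_top.2 ⟨hF.finite_vacuum, ?_⟩)
    exact (eLpNorm_map_mix_le hc hr hM hf.integrable).trans_lt
      (ENNReal.mul_lt_top ENNReal.ofReal_lt_top hF.finite_vacuum)
  · rw [functionMeasure, ← map_sub, mix_sub_smoothingChannel hf.integrable hP]
    exact eLpNorm_map_mix_le hc hr hM (hP.sub (integrable_smooth hf.integrable hP))
  · rw [functionMeasure, ← map_sub] at h0 ⊢
    have hv : F (vacuumState - smoothingChannel f vacuumState) = 0 :=
      (Lp.eq_zero_iff_ae_eq_zero).2
        ((eLpNorm_eq_zero_iff (Lp.aestronglyMeasurable _) (zero_lt_one.trans_le hr).ne').1 h0)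
    have hcoh : ∀ α, F (coherentState α - smoothingChannel f (coherentState α)) = 0 := fun α => by
      obtain ⟨V, -, hV⟩ := hF.covariant α
      rw [← displace_vacuumState_sub_smoothingChannel hf.integrable,
        hV _ (traceBound_vacuumState_sub hf.integrable).schattenNorm_lt_top, hv, map_zero]
    -- The vanishing is proved in the `L^q` norm, where `F` is continuous for trace bounds, and it
    -- then holds for the `L^p` norm too.
    have hz : F (mix P - smoothingChannel f (mix P)) = 0 := by
      have hlim : Filter.Tendsto (fun n : ℕ => (c : ℝ) * (1 / ((n : ℝ) + 1)))
          Filter.atTop (nhds 0) := by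
        simpa using tendsto_one_div_add_atTop_nhds_zero_nat.const_mul (c : ℝ)
      refine norm_le_zero_iff.1 (ge_of_tendsto' hlim fun n => ?_)
      obtain ⟨T, hTn, hFT⟩ := exists_traceBound_of_vanishing hf.integrable F hcoh hP
        (by positivity : (0 : ℝ) < 1 / ((n : ℝ) + 1))
      rw [hFT]
      exact norm_le_of_traceBound hc hTn
    rw [hz, eLpNorm_congr_ae (Lp.coeFn_zero ℂ q μ), eLpNorm_zero]

end NoGo

end

theorem mainTheorem1 (p : ℝ) (hp : 1 ≤ p) (f : ℂ → ℝ) (hf : NoGo.IsQuantumnessBreaking f) :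
    (∀ {K : Type*} [NormedAddCommGroup K] [InnerProductSpace ℂ K] [CompleteSpace K]
      (F : NoGo.Op →ₗ[ℂ] (K →L[ℂ] K)), NoGo.IsOperatorFunctional p F →
      NoGo.operatorMeasure p F f NoGo.vacuumState < ∞ ∧
      ∃ ρ : NoGo.Op, NoGo.IsDensityOperator ρ ∧ NoGo.HasNegativePFunction ρ ∧
        ¬ NoGo.IsClassicalState ρ ∧
        NoGo.operatorMeasure p F f ρ ≤ NoGo.operatorMeasure p F f NoGo.vacuumState ∧
        NoGo.witness (NoGo.operatorMeasure p F f) ρ ≤ 0 ∧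
        (NoGo.operatorMeasure p F f NoGo.vacuumState ≠ 0 →
          NoGo.witness (NoGo.operatorMeasure p F f) ρ < 0)) ∧
    (∀ {Ω : Type*} [MeasurableSpace Ω] (μ : Measure Ω) (q : ℝ≥0∞) [Fact (1 ≤ q)]
      (F : NoGo.Op →ₗ[ℂ] Lp ℂ q μ), NoGo.IsFunctionFunctional μ p q F →
      NoGo.functionMeasure μ p q F f NoGo.vacuumState < ∞ ∧
      ∃ ρ : NoGo.Op, NoGo.IsDensityOperator ρ ∧ NoGo.HasNegativePFunction ρ ∧
        ¬ NoGo.IsClassicalState ρ ∧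
        NoGo.functionMeasure μ p q F f ρ ≤ NoGo.functionMeasure μ p q F f NoGo.vacuumState ∧
        NoGo.witness (NoGo.functionMeasure μ p q F f) ρ ≤ 0 ∧
        (NoGo.functionMeasure μ p q F f NoGo.vacuumState ≠ 0 →
          NoGo.witness (NoGo.functionMeasure μ p q F f) ρ < 0)) :=
  ⟨fun F hF => NoGo.operatorMeasure_exists_undetected_state (by linarith) hf F hF,
    fun μ q _ F hF => NoGo.functionMeasure_exists_undetected_state hp hf μ q F hF⟩
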